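/- For each $n\ge 1$ let $\mathbf X\in\mathbb R^{n\times p}$ be a fixed design matrix whose columns have $\ell_2$-norm $\sqrt n$, let $S\subseteq\{1,\dots,p\}$, $s=|S|$ and $N=\{1,\dots,p\}\setminus S$; $p,\mathbf X,S$ may depend on $n$, which is suppressed in the notation. Let $\sigma>0$ be fixed and let $\mathbf y=\mathbf X\boldsymbol\beta+\sigma\boldsymbol\varepsilon$ with $\boldsymbol\varepsilon\sim\mathcal N_n(\mathbf 0,\mathbf I)$. A square-root Lasso regression of $\mathbf z\in\mathbb R^n$ on a matrix $\mathbf M$ with tuning parameter $t$ is any minimiser over $\mathbf b$ of $\|\mathbf z-\mathbf M\mathbf b\|_2/\sqrt n+t\|\mathbf b\|_1$; where minimisers are not unique, an arbitrary choice is fixed (as a function of $\mathbf z$). Let $\mathbf X_k$ be the $k$th column of $\mathbf X$ and $\mathbf X_{-k}$ the matrix $\mathbf X$ without it. Given $\lambda,\gamma$, let $\boldsymbol\Psi_k$ be the square-root Lasso regression of $\mathbf X_k$ on $\mathbf X_{-k}$ with tuning parameter $\gamma$, $\mathbf W_k=\mathbf X_k-\mathbf X_{-k}\boldsymbol\Psi_k$,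 let $\hat{\boldsymbol\Theta}_k$ and $\hat{\boldsymbol\beta}$ be the square-root Lasso regressions of $\mathbf y$ on $\mathbf X_{-k}$ and on $\mathbf X$ with tuning parameter $\lambda$, and $$T_k=\frac{\mathbf W_k^T(\mathbf y-\mathbf X_{-k}\hat{\boldsymbol\Theta}_k)}{\|\mathbf W_k\|_2\,\|\mathbf y-\mathbf X_{-k}\hat{\boldsymbol\Theta}_k\|_2/\sqrt n}.$$ Let $\check\sigma=\|\mathbf y-\mathbf X\hat{\boldsymbol\beta}\|_2/\sqrt n$ and $\mathbf y_k^*=\mathbf X_{-k}\hat{\boldsymbol\Theta}_k+\check\sigma\boldsymbol\varepsilon^*$, where $\boldsymbol\varepsilon^*\sim\mathcal N_n(\mathbf 0,\mathbf I)$ is independent of $\boldsymbol\varepsilon$; let $\hat{\boldsymbol\Theta}_k^*$ be the square-root Lasso regression of $\mathbf y_k^*$ on $\mathbf X_{-k}$ with tuning parameter $\lambda$, and let $T_k^*$ be given by the formula for $T_k$ with $\mathbf y,\hat{\boldsymbol\Theta}_k$ replaced by $\mathbf y_k^*,\hat{\boldsymbol\Theta}_k^*$. For $\xi>1$ define the compatibility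 factor $$\kappa(\xi,S)=\inf\Big\{\frac{\|\mathbf X\mathbf u\|_2/\sqrt n}{\|\mathbf u_S\|_1/\sqrt{|S|}}:\ \mathbf u\ne\mathbf 0,\ \|\mathbf u_{S^c}\|_1\le\xi\|\mathbf u_S\|_1\Big\}$$ ($=\infty$ if $S=\emptyset$). **Theorem.** Let $\lambda=A_1\sqrt{2\log(p)/n}$ for some constant $A_1>1$ and suppose that $s\sqrt{\log(p)^2/n}\,/\,\kappa^2(\xi,S)\to0$ as $n\to\infty$ for some constant $\xi>(A_1+1)/(A_1-1)$. Let $\gamma=A_2\sqrt{2\log(p)/n}$ for some constant $A_2>0$, and suppose that, for all sufficiently large $n$, $\mathbf W_k\ne\mathbf 0$ for every $k\in N$. Let $\mathscr B=\{\mathbf b\in\mathbb R^p:\mathbf b_N=\mathbf 0\}$ and let $\Phi$ be the standard normal distribution function. Then, as $n\to\infty$, $$\sup_{k\in N,\ \boldsymbol\beta\in\mathscr B,\ x\in\mathbb R}\big|\mathbb P(T_k\le x)-\Phi(x)\big|\to0,$$ $$\sup_{k\in N,\ \boldsymbol\beta\in\mathscr B,\ x\in\mathbb R}\big|\mathbb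 P(T_k^*\le x\mid\boldsymbol\varepsilon)-\Phi(x)\big|\ \xrightarrow{\ p\ }\ 0 .$$ -/

import Mathlib

open MeasureTheory ProbabilityTheory Filter Topology
open scoped ENNReal Matrix

namespace SqrtLassoTest

/-- The Euclidean norm `‖v‖₂`. -/
noncomputable def l2 {n : ℕ} (v : Fin n → ℝ) : ℝ := ‖WithLp.toLp 2 v‖

/-- The `ℓ₁` norm `‖b‖₁`. -/
def l1 {ι : Type*} [Fintype ι] (b : ι → ℝ) : ℝ := ∑ j, |b j|

/-- The square-root Lasso objective `‖y - M b‖₂ / √n + λ ‖b‖₁`. -/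
noncomputable def sqrtLassoObj {n : ℕ} {ι : Type*} [Fintype ι] (M : Matrix (Fin n) ι ℝ)
    (lam : ℝ) (y : Fin n → ℝ) (b : ι → ℝ) : ℝ :=
  l2 (y - M *ᵥ b) / √(n : ℝ) + lam * l1 b

/-- `b` is a square-root Lasso solution for the regression of `y` on `M` with tuning parameter
`lam`, i.e. a minimiser of the objective (minimisers need not be unique). -/
def IsSqrtLasso {n : ℕ} {ι : Type*} [Fintype ι] (M : Matrix (Fin n) ι ℝ)
    (lam : ℝ) (y : Fin n → ℝ) (b : ι → ℝ) : Prop :=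
  ∀ b' : ι → ℝ, sqrtLassoObj M lam y b ≤ sqrtLassoObj M lam y b'

/-- The cone `𝒞(ξ, T) = {u ≠ 0 : ‖u_{Tᶜ}‖₁ ≤ ξ ‖u_T‖₁}`. -/
def cone {ι : Type*} [Fintype ι] [DecidableEq ι] (ξ : ℝ) (T : Finset ι) : Set (ι → ℝ) :=
  {u | u ≠ 0 ∧ ∑ j ∈ Tᶜ, |u j| ≤ ξ * ∑ j ∈ T, |u j|}

/-- The compatibility factor
`κ(ξ, T, M) = inf {(‖M u‖₂ / √n) / (‖u_T‖₁ / √|T|) : u ∈ 𝒞(ξ, T)}`, with values in `[0, ∞]`.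
For `T = ∅` the cone is empty and the factor is `∞`; for `T ≠ ∅` the denominator is positive on
the cone. -/
noncomputable def compat {n : ℕ} {ι : Type*} [Fintype ι] [DecidableEq ι] (ξ : ℝ) (T : Finset ι)
    (M : Matrix (Fin n) ι ℝ) : ℝ≥0∞ :=
  ⨅ u ∈ cone ξ T,
    ENNReal.ofReal ((l2 (M *ᵥ u) / √(n : ℝ)) / ((∑ j ∈ T, |u j|) / √(T.card : ℝ)))

/-- `X_{-k}`: the matrix `X` with column `k` removed. -/
def dropCol {n p : ℕ} (X : Matrix (Fin n) (Fin p) ℝ) (k : Fin p) :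
    Matrix (Fin n) {j : Fin p // j ≠ k} ℝ :=
  X.submatrix id Subtype.val

/-- The nodewise residual `W_k = X_k - X_{-k} ψ`. -/
def nodewiseResid {n p : ℕ} (X : Matrix (Fin n) (Fin p) ℝ) (k : Fin p)
    (psi : {j : Fin p // j ≠ k} → ℝ) : Fin n → ℝ :=
  X.col k - dropCol X k *ᵥ psi

/-- The regularised partial correlation
`T_k = W_kᵀ (y - X_{-k} Θ̂(y)) / (‖W_k‖₂ ‖y - X_{-k} Θ̂(y)‖₂ / √n)`
as a function of the response `y`, where `Θ̂ = theta` is an estimator of the coefficients in the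
regression on `X_{-k}`. -/
noncomputable def testStat {n p : ℕ} (X : Matrix (Fin n) (Fin p) ℝ) (k : Fin p)
    (psi : {j : Fin p // j ≠ k} → ℝ) (theta : (Fin n → ℝ) → ({j : Fin p // j ≠ k} → ℝ))
    (y : Fin n → ℝ) : ℝ :=
  (nodewiseResid X k psi ⬝ᵥ (y - dropCol X k *ᵥ theta y)) /
    (l2 (nodewiseResid X k psi) * l2 (y - dropCol X k *ᵥ theta y) / √(n : ℝ))

/-- The response `y = X β + σ ε` of the linear model. -/
def response {n p : ℕ} (X : Matrix (Fin n) (Fin p) ℝ) (β : Fin p → ℝ) (σ : ℝ)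
    (e : Fin n → ℝ) : Fin n → ℝ :=
  X *ᵥ β + σ • e

/-- The normalised root residual sum of squares `σ̌ = ‖y - X β̂(y)‖₂ / √n`. -/
noncomputable def sigmaCheck {n p : ℕ} (X : Matrix (Fin n) (Fin p) ℝ)
    (bhat : (Fin n → ℝ) → (Fin p → ℝ)) (y : Fin n → ℝ) : ℝ :=
  l2 (y - X *ᵥ bhat y) / √(n : ℝ)

/-- The bootstrap response `y*_k = X_{-k} Θ̂(y) + σ̌(y) ε*`. -/
noncomputable def bootResponse {n p : ℕ} (X : Matrix (Fin n) (Fin p) ℝ) (k : Fin p)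
    (theta : (Fin n → ℝ) → ({j : Fin p // j ≠ k} → ℝ)) (bhat : (Fin n → ℝ) → (Fin p → ℝ))
    (y estar : Fin n → ℝ) : Fin n → ℝ :=
  dropCol X k *ᵥ theta y + sigmaCheck X bhat y • estar

/-- The law `N_n(0, I)`. -/
noncomputable def stdNormal (n : ℕ) : Measure (Fin n → ℝ) :=
  Measure.pi fun _ => gaussianReal 0 1

/-- The standard normal distribution function `Φ`. -/
noncomputable def Phi (x : ℝ) : ℝ := cdf (gaussianReal 0 1) x

/-- `P(T_k ≤ x)` when `y = X β + σ ε` with `ε ∼ N_n(0, I)`. -/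
noncomputable def statCDF {n p : ℕ} (X : Matrix (Fin n) (Fin p) ℝ) (k : Fin p)
    (psi : {j : Fin p // j ≠ k} → ℝ) (theta : (Fin n → ℝ) → ({j : Fin p // j ≠ k} → ℝ))
    (β : Fin p → ℝ) (σ x : ℝ) : ℝ :=
  (stdNormal n).real {e | testStat X k psi theta (response X β σ e) ≤ x}

/-- `P(T*_k ≤ x | ε = e)`. The statistic `T*_k` is the statistic `T_k` computed from `y*_k`, and
`ε* ∼ N_n(0, I)` is independent of `ε`, so that the (regular) conditional probability given
`ε = e` is the probability over `ε*` with `e` held fixed. -/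
noncomputable def bootCDF {n p : ℕ} (X : Matrix (Fin n) (Fin p) ℝ) (k : Fin p)
    (psi : {j : Fin p // j ≠ k} → ℝ) (theta : (Fin n → ℝ) → ({j : Fin p // j ≠ k} → ℝ))
    (bhat : (Fin n → ℝ) → (Fin p → ℝ)) (β : Fin p → ℝ) (σ : ℝ) (e : Fin n → ℝ) (x : ℝ) : ℝ :=
  (stdNormal n).real
    {estar | testStat X k psi theta (bootResponse X k theta bhat (response X β σ e) estar) ≤ x}

/-- `ℬ = {b ∈ ℝᵖ : b_N = 0}`, where `N` is the complement of `S`. -/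
def supportedOn {p : ℕ} (S : Finset (Fin p)) : Set (Fin p → ℝ) := {b | ∀ j, j ∉ S → b j = 0}

end SqrtLassoTest

/-! For `k ∉ S` the coefficient `β k` vanishes, so the response is `X_{-k} b + σ ε` with `b`
supported on `S`. The statistic is then compared with `Z = W_kᵀ ε / ‖W_k‖₂`, which is exactly
standard normal. The difference has two sources. The bias `W_kᵀ X_{-k}(Θ̂ - b) / ‖W_k‖₂` is at most
`γ √n ‖Θ̂ - b‖₁` by the optimality conditions of the nodewise regression
(`IsSqrtLasso.dotProduct_resid_le`). The scale error, residual norm against noise norm, is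
controlled with the `ℓ₁` error by the oracle inequality `exists_const_sqrtLasso`. Both are
negligible because `√n` times the oracle rate tends to zero; this is the compatibility hypothesis
(`compatBound_of_div_le`).

In the bootstrap the true coefficient vector is `Θ̂(y)`, which need not be sparse. Its `ℓ₁` mass off
`S` is however part of the estimation error of `Θ̂(y)`, already bounded by the first application of
the oracle inequality. The inequality is therefore proved for targets with small off-support mass
`d`, and is applied a second time with this `d` (`exists_closeness`).

The number of columns need not grow, and for bounded `p` the union bound over columns does not have
vanishing failure probability. Hence the two alternatives in `NoiseBound`: for large `p` all column
correlations lie below `θ λ`; for bounded `p` the projection of the noise on the column space has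
bounded norm, which costs only `a² = K / n` (`exists_eventually_goodNoise`).

Estimators are arbitrary selections of minimisers, so only monotonicity and subadditivity of the
measure are used on events that involve them. -/

namespace SqrtLassoTest

/-! ### Euclidean and `ℓ₁` norms. -/

section Norms

variable {n : ℕ} {ι : Type*} [Fintype ι]

lemma l2_nonneg (v : Fin n → ℝ) : 0 ≤ l2 v := norm_nonneg _

lemma l2_sq (v : Fin n → ℝ) : l2 v ^ 2 = v ⬝ᵥ v := by
  simp only [l2, EuclideanSpace.norm_sq_eq, dotProduct, Real.norm_eq_abs, sq_abs]
  exact Finset.sum_congr rfl fun i _ => sq _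

lemma l2_smul (c : ℝ) (v : Fin n → ℝ) : l2 (c • v) = |c| * l2 v := by
  simp [l2, norm_smul]

lemma l2_eq_zero {v : Fin n → ℝ} : l2 v = 0 ↔ v = 0 := by
  simp [l2]

lemma l2_pos {v : Fin n → ℝ} (h : v ≠ 0) : 0 < l2 v :=
  lt_of_le_of_ne (l2_nonneg v) fun h0 => h (l2_eq_zero.1 h0.symm)

lemma abs_dotProduct_le (v w : Fin n → ℝ) : |v ⬝ᵥ w| ≤ l2 v * l2 w := by
  have := abs_real_inner_le_norm (WithLp.toLp 2 w) (WithLp.toLp 2 v)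
  simpa [l2, EuclideanSpace.inner_toLp_toLp, mul_comm] using this

lemma dotProduct_le_l2_mul (v w : Fin n → ℝ) : v ⬝ᵥ w ≤ l2 v * l2 w :=
  (le_abs_self _).trans (abs_dotProduct_le v w)

lemma l2_sub_sq (v w : Fin n → ℝ) : l2 (v - w) ^ 2 = l2 v ^ 2 - 2 * (v ⬝ᵥ w) + l2 w ^ 2 := by
  simp only [l2_sq, sub_dotProduct, dotProduct_sub, dotProduct_comm w v]
  ring

lemma l1_nonneg (b : ι → ℝ) : 0 ≤ l1 b := Finset.sum_nonneg fun _ _ => abs_nonneg _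

lemma l1_smul (c : ℝ) (b : ι → ℝ) : l1 (c • b) = |c| * l1 b := by
  simp [l1, abs_mul, Finset.mul_sum]

lemma l1_neg (b : ι → ℝ) : l1 (-b) = l1 b := by simp [l1]

lemma l1_add_le (b c : ι → ℝ) : l1 (b + c) ≤ l1 b + l1 c := by
  simp only [l1, ← Finset.sum_add_distrib]
  exact Finset.sum_le_sum fun j _ => abs_add_le _ _

lemma sum_add_sum_compl_abs [DecidableEq ι] (T : Finset ι) (b : ι → ℝ) :
    ∑ j ∈ T, |b j| + ∑ j ∈ Tᶜ, |b j| = l1 b := Finset.sum_add_sum_compl _ _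

end Norms

/-! ### The oracle inequality and the optimality conditions. -/

/-- The numerical core of the oracle inequality: `Q` and `Q'` are the root mean squares of the
noise and of the residuals, `h` and `g` the penalised `ℓ₁` errors on and off the support, `V` the
prediction error. -/
lemma exists_const_oracle {θ ξ : ℝ} (hθ0 : 0 ≤ θ) (hθ1 : θ < 1) (hξ : 1 + θ < ξ * (1 - θ)) :
    ∃ C : ℝ, 0 < C ∧ ∀ Q Q' V h g ρ d α : ℝ, 0 < Q → 0 ≤ Q' → 0 ≤ V → 0 ≤ h → 0 ≤ g →
      0 ≤ ρ → 0 ≤ d → 0 ≤ α → d ≤ 1 → ρ ≤ 1 / 16 →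
      Q' - Q ≤ h - g + 2 * d * Q →
      (1 - α) * Q - θ * (h + g) ≤ Q' →
      V ≤ Q' ^ 2 - Q ^ 2 + 2 * Q * (θ * (h + g)) + V / 2 + 2 * α * Q ^ 2 →
      (g ≤ ξ * h → h ^ 2 ≤ ρ * V) →
      h + g ≤ C * (ρ + d + α) * Q := by
  have hξ1 : 1 < ξ := by nlinarith
  -- The slack by which the cone constant `ξ` exceeds `(1 + θ) / (1 - θ)`.
  set ω := ξ * (1 - θ) - (1 + θ) with hω
  have hω0 : 0 < ω := by linarith
  have h1θ : 0 < 1 - θ := by linarith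
  set c := 4 * (4 + 2 * ξ) with hc
  refine ⟨(1 + ξ) * (c + 7) + 2 / ω + (2 * (1 + θ) / ω + 2) / (1 - θ), by positivity, ?_⟩
  intro Q Q' V h g ρ d α hQ hQ' hV hh hg hρ hd hα hd1 hρ1 hopt hH hH2 hcmp
  set w := ρ + d + α with hw
  have hw0 : 0 ≤ w := by positivity
  have key : (1 - θ) * g ≤ (1 + θ) * h + 2 * w * Q := by
    have : 0 ≤ ρ * Q := by positivity
    have : 0 ≤ α * Q := by positivity
    rw [hw]; linarith
  have hwQ : 0 ≤ w * Q := by positivity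
  -- Inside the cone, compatibility turns the prediction bound into a quadratic inequality for `h`.
  -- Outside it, `key` together with `g > ξ h` already forces `ω h ≤ 2 w Q`, and compatibility is
  -- not needed.
  by_cases hcone : g ≤ ξ * h
  · have hhV := hcmp hcone
    set m := h + 2 * d * Q with hm
    have hm0 : 0 ≤ m := by positivity
    have e1 : Q' ^ 2 - Q ^ 2 ≤ 2 * Q * m + m ^ 2 := by
      have : Q' ≤ Q + m := by linarith
      have := pow_le_pow_left₀ hQ' this 2
      linarith
    have e2 : θ * (h + g) ≤ (1 + ξ) * h := by
      have := mul_le_mul_of_nonneg_right hθ1.le (add_nonneg hh hg)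
      linarith
    have e3 : V ≤ 2 * (2 * Q * m + m ^ 2 + 2 * Q * ((1 + ξ) * h) + 2 * α * Q ^ 2) := by
      have := mul_le_mul_of_nonneg_left e2 (by positivity : 0 ≤ 2 * Q)
      linarith
    have e4 : m ^ 2 ≤ 2 * h ^ 2 + 8 * d * Q ^ 2 := by
      have : d ^ 2 * Q ^ 2 ≤ d * Q ^ 2 := by
        apply mul_le_mul_of_nonneg_right _ (sq_nonneg _); nlinarith
      rw [hm]; linarith [sq_nonneg (h - 2 * d * Q)]
    have e5 : V ≤ 4 * h ^ 2 + 4 * (2 + ξ) * Q * h + (24 * d + 4 * α) * Q ^ 2 := by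
      rw [hm] at e3 e4
      linarith
    have e6 : h ^ 2 ≤ ρ * (4 * h ^ 2 + 4 * (2 + ξ) * Q * h + (24 * d + 4 * α) * Q ^ 2) :=
      hhV.trans (mul_le_mul_of_nonneg_left e5 hρ)
    -- Smallness of `ρ` lets the quadratic term be absorbed on the left.
    have e7 : ρ * (4 * h ^ 2) ≤ h ^ 2 / 2 := by
      have := mul_le_mul_of_nonneg_right hρ1 (sq_nonneg h)
      linarith [sq_nonneg h]
    have e8 : h ^ 2 ≤ 2 * (ρ * (4 * (2 + ξ) * Q * h)) + 2 * (ρ * (24 * d + 4 * α)) * Q ^ 2 := by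
      linarith
    have e9 : ρ * (24 * d + 4 * α) ≤ 24 * w ^ 2 := by
      calc ρ * (24 * d + 4 * α) ≤ w * (24 * w) :=
            mul_le_mul (by linarith) (by linarith) (by positivity) hw0
        _ = 24 * w ^ 2 := by ring
    have e10 : ρ * (4 * (2 + ξ) * Q * h) ≤ w * (4 * (2 + ξ) * Q * h) :=
      mul_le_mul_of_nonneg_right (by linarith) (by positivity)
    have e11 : h ^ 2 ≤ c * (w * Q) * h + 48 * (w * Q) ^ 2 := by
      have := mul_le_mul_of_nonneg_right e9 (sq_nonneg Q)
      rw [hc]; linarith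
    -- Otherwise `e11` leaves `7 (w Q) h ≤ 48 (w Q) ^ 2`, while `h ≥ 7 (w Q)`; the constant 7 is
    -- chosen because `7 ^ 2 > 48`.
    have e12 : h ≤ (c + 7) * (w * Q) := by
      by_contra! hcon
      have hc0 : 0 ≤ c := by positivity
      have : (c + 7) * (w * Q) * h ≤ h * h := mul_le_mul_of_nonneg_right hcon.le hh
      have h7 : 7 * (w * Q) ≤ h := by linarith [mul_nonneg hc0 hwQ]
      have h49 := mul_le_mul_of_nonneg_left h7 hwQ
      have hz : (w * Q) ^ 2 ≤ 0 := by linarith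
      have hz0 : w * Q = 0 := by simpa using le_antisymm hz (sq_nonneg _)
      rw [hz0] at hcon e11
      nlinarith
    have e13 : h + g ≤ (1 + ξ) * ((c + 7) * (w * Q)) := by
      have := mul_le_mul_of_nonneg_left e12 (by linarith : 0 ≤ 1 + ξ)
      linarith
    have : 0 ≤ (2 / ω + (2 * (1 + θ) / ω + 2) / (1 - θ)) * (w * Q) := by positivity
    linarith
  · push Not at hcone
    have a1 : h ≤ 2 / ω * (w * Q) := by
      have : ω * h ≤ 2 * (w * Q) := by
        have := mul_le_mul_of_nonneg_left hcone.le h1θ.le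
        rw [hω]; linarith
      rw [div_mul_eq_mul_div, le_div_iff₀ hω0]; linarith
    have a2 : g ≤ (2 * (1 + θ) / ω + 2) / (1 - θ) * (w * Q) := by
      rw [div_mul_eq_mul_div, le_div_iff₀ h1θ]
      have := mul_le_mul_of_nonneg_left a1 (by linarith : 0 ≤ 1 + θ)
      calc g * (1 - θ) ≤ (1 + θ) * (2 / ω * (w * Q)) + 2 * w * Q := by linarith
        _ = _ := by ring
    have : 0 ≤ (1 + ξ) * (c + 7) * (w * Q) := by positivity
    linarith

section Deterministic

variable {n : ℕ} {ι : Type*} [Fintype ι]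

/-- The correlation of `e` with the fitted values `M u` is small, either relative to `‖u‖₁` or
relative to `‖M u‖₂`. -/
def NoiseBound (M : Matrix (Fin n) ι ℝ) (τ a : ℝ) (e : Fin n → ℝ) : Prop :=
  ∀ u, e ⬝ᵥ (M *ᵥ u) ≤ l2 e * (τ * √(n : ℝ) * l1 u) ∨ e ⬝ᵥ (M *ᵥ u) ≤ l2 e * (a * l2 (M *ᵥ u))

lemma NoiseBound.smul {M : Matrix (Fin n) ι ℝ} {τ a c : ℝ} {e : Fin n → ℝ}
    (h : NoiseBound M τ a e) (hc : 0 < c) : NoiseBound M τ a (c • e) := by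
  intro u
  simp only [smul_dotProduct, l2_smul, abs_of_pos hc, smul_eq_mul, mul_assoc]
  refine (h u).imp (fun h => ?_) fun h => ?_
  · simpa only [mul_assoc] using mul_le_mul_of_nonneg_left h hc.le
  · exact mul_le_mul_of_nonneg_left h hc.le

/-- In the second alternative, Young's inequality moves half of the squared prediction error to the
right, where the oracle argument absorbs it. -/
lemma NoiseBound.two_mul_dotProduct_le {M : Matrix (Fin n) ι ℝ} {τ a : ℝ} {e : Fin n → ℝ}
    (h : NoiseBound M τ a e) (hτ : 0 ≤ τ) (u : ι → ℝ) :
    2 * (e ⬝ᵥ (M *ᵥ u)) ≤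
      2 * (l2 e * (τ * √(n : ℝ) * l1 u)) + l2 (M *ᵥ u) ^ 2 / 2 + 2 * a ^ 2 * l2 e ^ 2 := by
  have h1 := l2_nonneg e
  have h2 : 0 ≤ l2 e * (τ * √(n : ℝ) * l1 u) := by have := l1_nonneg u; positivity
  rcases h u with h | h
  · have : 0 ≤ a ^ 2 * l2 e ^ 2 := by positivity
    have := sq_nonneg (l2 (M *ᵥ u))
    linarith
  · linarith [sq_nonneg (l2 (M *ᵥ u) - 2 * (a * l2 e))]

/-- In the first alternative, pair `e - M u` with `e` and apply Cauchy–Schwarz. In the second,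
completing the square gives `‖e - M u‖² ≥ (1 - a²) ‖e‖²`, and the square root of `1 - a²` is at
least `1 - a²`. -/
lemma NoiseBound.le_l2_sub {M : Matrix (Fin n) ι ℝ} {τ a : ℝ} {e : Fin n → ℝ}
    (h : NoiseBound M τ a e) (hτ : 0 ≤ τ) (u : ι → ℝ) :
    (1 - a ^ 2) * l2 e - τ * √(n : ℝ) * l1 u ≤ l2 (e - M *ᵥ u) := by
  have h1 := l2_nonneg e
  have h2 : 0 ≤ τ * √(n : ℝ) * l1 u := by have := l1_nonneg u; positivity
  have h3 := l2_nonneg (e - M *ᵥ u)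
  rcases h1.eq_or_lt with h0 | h0
  · rw [← h0]; linarith
  rcases h u with h | h
  · have hc := dotProduct_le_l2_mul e (e - M *ᵥ u)
    rw [dotProduct_sub, ← l2_sq] at hc
    have : l2 e * (l2 e - τ * √(n : ℝ) * l1 u) ≤ l2 e * l2 (e - M *ᵥ u) := by linarith
    have := le_of_mul_le_mul_left this h0
    have : 0 ≤ a ^ 2 * l2 e := by positivity
    linarith
  · suffices (1 - a ^ 2) * l2 e ≤ l2 (e - M *ᵥ u) by linarith
    by_cases ha1 : a ^ 2 ≤ 1
    · have hs := l2_sub_sq e (M *ᵥ u)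
      have h4 : (1 - a ^ 2) * l2 e ^ 2 ≤ l2 (e - M *ᵥ u) ^ 2 := by
        linarith [sq_nonneg (l2 (M *ᵥ u) - a * l2 e)]
      refine le_of_sq_le_sq ?_ h3
      calc ((1 - a ^ 2) * l2 e) ^ 2 = (1 - a ^ 2) * ((1 - a ^ 2) * l2 e ^ 2) := by ring
        _ ≤ 1 * ((1 - a ^ 2) * l2 e ^ 2) :=
          mul_le_mul_of_nonneg_right (by linarith [sq_nonneg a])
            (mul_nonneg (by linarith) (sq_nonneg _))
        _ ≤ _ := by linarith
    · nlinarith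

/-- The compatibility condition on `M` in product form. -/
def CompatBound [DecidableEq ι] (M : Matrix (Fin n) ι ℝ) (T : Finset ι) (ξ lam ρ : ℝ) : Prop :=
  ∀ u : ι → ℝ, ∑ j ∈ Tᶜ, |u j| ≤ ξ * ∑ j ∈ T, |u j| →
    (lam * ∑ j ∈ T, |u j|) ^ 2 ≤ ρ * (l2 (M *ᵥ u) ^ 2 / n)

/-- Triangle inequality on `T` and on its complement; the last term is the price of a target that is
only approximately sparse. -/
lemma sum_abs_sub_sum_abs_le [DecidableEq ι] (T : Finset ι) (b u : ι → ℝ) :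
    l1 b - l1 (b + u) ≤ ∑ j ∈ T, |u j| - ∑ j ∈ Tᶜ, |u j| + 2 * ∑ j ∈ Tᶜ, |b j| := by
  rw [← sum_add_sum_compl_abs T b, ← sum_add_sum_compl_abs T (b + u)]
  have h1 : ∑ j ∈ T, |b j| ≤ ∑ j ∈ T, |(b + u) j| + ∑ j ∈ T, |u j| := by
    rw [← Finset.sum_add_distrib]
    refine Finset.sum_le_sum fun j _ => ?_
    have := abs_sub ((b + u) j) (u j)
    simpa using this
  have h2 : ∑ j ∈ Tᶜ, |u j| ≤ ∑ j ∈ Tᶜ, |(b + u) j| + ∑ j ∈ Tᶜ, |b j| := by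
    rw [← Finset.sum_add_distrib]
    refine Finset.sum_le_sum fun j _ => ?_
    have := abs_sub ((b + u) j) (b j)
    simpa using this
  linarith

/-- Oracle inequality for the square-root Lasso with an approximately sparse target `b`. -/
theorem exists_const_sqrtLasso {θ ξ : ℝ} (hθ0 : 0 ≤ θ) (hθ1 : θ < 1)
    (hξ : 1 + θ < ξ * (1 - θ)) :
    ∃ C : ℝ, 0 < C ∧ ∀ {n : ℕ} {ι : Type} [Fintype ι] [DecidableEq ι] (M : Matrix (Fin n) ι ℝ)
      (T : Finset ι) (lam ρ d a : ℝ) (b bh : ι → ℝ) (r : Fin n → ℝ), n ≠ 0 → r ≠ 0 →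
      0 ≤ lam → 0 ≤ ρ → 0 ≤ d → 0 ≤ a → d ≤ 1 → ρ ≤ 1 / 16 →
      IsSqrtLasso M lam (M *ᵥ b + r) bh → NoiseBound M (θ * lam) a r →
      CompatBound M T ξ lam ρ →
      lam * ∑ j ∈ Tᶜ, |b j| ≤ d * (l2 r / √(n : ℝ)) →
      lam * l1 (bh - b) ≤ C * (ρ + d + a ^ 2) * (l2 r / √(n : ℝ)) ∧
      |l2 (M *ᵥ b + r - M *ᵥ bh) / √(n : ℝ) - l2 r / √(n : ℝ)| ≤
        (C * (ρ + d + a ^ 2) + a ^ 2) * (l2 r / √(n : ℝ)) := by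
  obtain ⟨C, hC, H⟩ := exists_const_oracle hθ0 hθ1 hξ
  refine ⟨C, hC, ?_⟩
  intro n ι _ _ M T lam ρ d a b bh r hn hr hlam hρ hd ha hd1 hρ1 hbh hnoise hcomp hslack
  obtain ⟨u, rfl⟩ : ∃ u, bh = b + u := ⟨bh - b, by simp⟩
  have hres : M *ᵥ b + r - M *ᵥ (b + u) = r - M *ᵥ u := by
    rw [Matrix.mulVec_add]; abel
  rw [hres, add_sub_cancel_left]
  have hn0 : (0 : ℝ) < √(n : ℝ) := Real.sqrt_pos.2 (by positivity)
  have hnn : √(n : ℝ) ^ 2 = n := Real.sq_sqrt (by positivity)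
  set Q := l2 r / √(n : ℝ) with hQ
  set Q' := l2 (r - M *ᵥ u) / √(n : ℝ) with hQ'
  have hr' : l2 r = Q * √(n : ℝ) := by rw [hQ]; field_simp
  have hr'' : l2 (r - M *ᵥ u) = Q' * √(n : ℝ) := by rw [hQ']; field_simp
  have hQ0 : 0 < Q := div_pos (l2_pos hr) hn0
  have hQ'0 : 0 ≤ Q' := div_nonneg (l2_nonneg _) hn0.le
  have hτ : 0 ≤ θ * lam := mul_nonneg hθ0 hlam
  have hsplit : lam * ∑ j ∈ T, |u j| + lam * ∑ j ∈ Tᶜ, |u j| = lam * l1 u := by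
    rw [← sum_add_sum_compl_abs T u]; ring
  have hopt : Q' - Q ≤ lam * (l1 b - l1 (b + u)) := by
    have h1 := hbh b
    simp only [sqrtLassoObj, hres, add_sub_cancel_left] at h1
    linarith
  have hlow : (1 - a ^ 2) * Q - θ * (lam * l1 u) ≤ Q' := by
    have h1 := hnoise.le_l2_sub hτ u
    rw [hr', hr''] at h1
    refine le_of_mul_le_mul_right ?_ hn0
    linarith
  have hsum : 0 ≤ lam * l1 u := mul_nonneg hlam (l1_nonneg u)
  have hmain : lam * l1 u ≤ C * (ρ + d + a ^ 2) * Q := by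
    rw [← hsplit] at hlow ⊢
    refine H Q Q' (l2 (M *ᵥ u) ^ 2 / n) _ _ ρ d (a ^ 2) hQ0 hQ'0 (by positivity)
      (mul_nonneg hlam (Finset.sum_nonneg fun _ _ => abs_nonneg _))
      (mul_nonneg hlam (Finset.sum_nonneg fun _ _ => abs_nonneg _)) hρ hd (sq_nonneg a) hd1 hρ1
      ?_ hlow ?_ ?_
    · have h1 := mul_le_mul_of_nonneg_left (sum_abs_sub_sum_abs_le T b u) hlam
      linarith
    · have h1 := hnoise.two_mul_dotProduct_le hτ u
      have h2 := l2_sub_sq r (M *ᵥ u)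
      rw [hsplit]
      rw [hr', hr''] at *
      rw [← hnn]
      set V := l2 (M *ᵥ u) ^ 2
      have hn2 : 0 < √(n : ℝ) ^ 2 := by positivity
      have h3 : V = (V / √(n : ℝ) ^ 2) * √(n : ℝ) ^ 2 := by field_simp
      rw [h3] at h1 h2
      refine le_of_mul_le_mul_right ?_ hn2
      linarith
    · intro hle
      -- With `lam = 0` the weighted inequality says nothing about the cone, but the claim is
      -- trivial. This occurs when `p = 1`.
      rcases hlam.eq_or_lt with h0 | h0
      · rw [← h0]
        simp only [zero_mul, ne_eq, OfNat.ofNat_ne_zero, not_false_eq_true, zero_pow]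
        positivity
      · refine hcomp u (le_of_mul_le_mul_left ?_ h0)
        linarith
  -- The lower bound on the residual scale comes from the noise estimate `hlow`, the upper one from
  -- comparing the minimiser with `b`.
  refine ⟨hmain, abs_le.2 ⟨?_, ?_⟩⟩
  · have := mul_le_mul_of_nonneg_right hθ1.le hsum
    linarith
  · have h1 := l1_add_le (b + u) (-u)
    rw [add_neg_cancel_right, l1_neg] at h1
    have h2 := mul_le_mul_of_nonneg_left h1 hlam
    have : 0 ≤ a ^ 2 * Q := by positivity
    linarith

/-- The Karush–Kuhn–Tucker bound for square-root Lasso residuals. -/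
lemma IsSqrtLasso.dotProduct_resid_le {M : Matrix (Fin n) ι ℝ} {t : ℝ} {z : Fin n → ℝ}
    {b : ι → ℝ} (h : IsSqrtLasso M t z b) (hn : n ≠ 0) (ht : 0 ≤ t) (w : ι → ℝ) :
    (z - M *ᵥ b) ⬝ᵥ (M *ᵥ w) ≤ t * √(n : ℝ) * l2 (z - M *ᵥ b) * l1 w := by
  have hn0 : (0 : ℝ) < √(n : ℝ) := Real.sqrt_pos.2 (by positivity)
  set W := z - M *ᵥ b with hW
  -- Perturb the minimiser by `c • w`, expand the square, and let `c` tend to zero. No derivative of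
  -- the norm is taken, so a zero residual is no exception.
  have key : ∀ c : ℝ, 0 < c →
      W ⬝ᵥ (M *ᵥ w) ≤ t * √(n : ℝ) * l2 W * l1 w + c / 2 * l2 (M *ᵥ w) ^ 2 := by
    intro c hc
    have h1 := h (b + c • w)
    have e1 : z - M *ᵥ (b + c • w) = W - M *ᵥ (c • w) := by
      rw [Matrix.mulVec_add, hW]; abel
    have e2 : l1 (b + c • w) ≤ l1 b + c * l1 w := by
      simpa [l1_smul, abs_of_pos hc] using l1_add_le b (c • w)
    simp only [sqrtLassoObj, e1] at h1
    rw [← hW] at h1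
    have h2 : l2 W / √(n : ℝ) - t * (c * l1 w) ≤ l2 (W - M *ᵥ (c • w)) / √(n : ℝ) := by
      have := mul_le_mul_of_nonneg_left e2 ht
      linarith
    have h3 : l2 W - t * (c * l1 w) * √(n : ℝ) ≤ l2 (W - M *ᵥ (c • w)) := by
      have := mul_le_mul_of_nonneg_right h2 hn0.le
      rwa [sub_mul, div_mul_cancel₀ _ hn0.ne', div_mul_cancel₀ _ hn0.ne'] at this
    have hq := l2_sub_sq W (M *ᵥ (c • w))
    rw [Matrix.mulVec_smul, dotProduct_smul, smul_eq_mul, l2_smul, abs_of_pos hc] at hq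
    rw [Matrix.mulVec_smul] at h3
    have hW0 := l2_nonneg W
    have hR0 := l2_nonneg (W - c • M *ᵥ w)
    -- From `R² ≥ 2 ‖W‖ R - ‖W‖²`, which avoids squaring a lower bound that may be negative.
    have h4 : l2 W ^ 2 - 2 * l2 W * (t * (c * l1 w) * √(n : ℝ)) ≤ l2 (W - c • M *ᵥ w) ^ 2 := by
      nlinarith [sq_nonneg (l2 W - l2 (W - c • M *ᵥ w))]
    refine le_of_mul_le_mul_left ?_ (by positivity : 0 < 2 * c)
    linarith
  have hlim : Tendsto (fun c : ℝ => t * √(n : ℝ) * l2 W * l1 w + c / 2 * l2 (M *ᵥ w) ^ 2)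
      (𝓝[>] 0) (𝓝 (t * √(n : ℝ) * l2 W * l1 w + 0 / 2 * l2 (M *ᵥ w) ^ 2)) := by
    refine Tendsto.mono_left (Continuous.tendsto ?_ 0) nhdsWithin_le_nhds
    fun_prop
  rw [zero_div, zero_mul, add_zero] at hlim
  exact ge_of_tendsto hlim (eventually_mem_nhdsWithin.mono key)

end Deterministic

/-! ### Removing a column. -/

section DropCol

variable {n p : ℕ}

/-- Extension by zero of a coefficient vector for `X_{-k}`. -/
def extendZero (k : Fin p) (u : {j : Fin p // j ≠ k} → ℝ) : Fin p → ℝ :=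
  fun j => if h : j ≠ k then u ⟨j, h⟩ else 0

lemma sum_extendZero {k : Fin p} (f : {j : Fin p // j ≠ k} → ℝ) (g : Fin p → ℝ)
    (hg : ∀ j, g j = if h : j ≠ k then f ⟨j, h⟩ else 0) : ∑ j, g j = ∑ j, f j := by
  rw [← Fintype.sum_subtype_add_sum_subtype (fun j => j ≠ k) g]
  have : ∑ i : {j // ¬ j ≠ k}, g i = 0 :=
    Finset.sum_eq_zero fun i _ => by rw [hg, dif_neg i.2]
  rw [this, add_zero]
  exact Finset.sum_congr rfl fun i _ => by rw [hg, dif_pos i.2]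

lemma mulVec_extendZero (X : Matrix (Fin n) (Fin p) ℝ) (k : Fin p)
    (u : {j : Fin p // j ≠ k} → ℝ) : X *ᵥ extendZero k u = dropCol X k *ᵥ u := by
  ext i
  refine sum_extendZero (k := k) (fun j => dropCol X k i j * u j)
    (fun j => X i j * extendZero k u j) fun j => ?_
  by_cases h : j = k <;> simp [extendZero, dropCol, h]

lemma l1_extendZero (k : Fin p) (u : {j : Fin p // j ≠ k} → ℝ) : l1 (extendZero k u) = l1 u := by
  refine sum_extendZero _ _ fun j => ?_
  by_cases h : j = k <;> simp [extendZero, h]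

lemma sum_abs_extendZero (k : Fin p) (S : Finset (Fin p)) (u : {j : Fin p // j ≠ k} → ℝ) :
    ∑ j ∈ S, |extendZero k u j| = ∑ j ∈ S.subtype (· ≠ k), |u j| := by
  rw [← Finset.sum_filter_add_sum_filter_not S (· ≠ k)]
  have : ∑ j ∈ S with ¬ j ≠ k, |extendZero k u j| = 0 :=
    Finset.sum_eq_zero fun j hj => by simp [extendZero, (Finset.mem_filter.1 hj).2]
  rw [this, add_zero, ← Finset.subtype_map, Finset.sum_map]
  exact Finset.sum_congr rfl fun j _ => by simp [extendZero, j.2]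

lemma sum_compl_abs_extendZero (k : Fin p) (S : Finset (Fin p)) (u : {j : Fin p // j ≠ k} → ℝ) :
    ∑ j ∈ Sᶜ, |extendZero k u j| = ∑ j ∈ (S.subtype (· ≠ k))ᶜ, |u j| := by
  have h1 := sum_add_sum_compl_abs S (extendZero k u)
  have h2 := sum_add_sum_compl_abs (S.subtype (· ≠ k)) u
  rw [l1_extendZero, sum_abs_extendZero] at h1
  linarith

/-- Zero padding preserves fitted values and `ℓ₁` norm, so one noise event for `X` serves every `k`
simultaneously. -/
lemma NoiseBound.dropCol {X : Matrix (Fin n) (Fin p) ℝ} {τ a : ℝ} {e : Fin n → ℝ}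
    (h : NoiseBound X τ a e) (k : Fin p) : NoiseBound (dropCol X k) τ a e := by
  intro u
  have := h (extendZero k u)
  rwa [mulVec_extendZero, l1_extendZero] at this

lemma CompatBound.dropCol {X : Matrix (Fin n) (Fin p) ℝ} {S : Finset (Fin p)} {ξ lam ρ : ℝ}
    (h : CompatBound X S ξ lam ρ) (k : Fin p) :
    CompatBound (dropCol X k) (S.subtype (· ≠ k)) ξ lam ρ := by
  intro u hu
  have := h (extendZero k u)
  rw [mulVec_extendZero, sum_compl_abs_extendZero, sum_abs_extendZero] at this
  exact this hu

lemma extendZero_restrict {k : Fin p} {β : Fin p → ℝ} (hk : β k = 0) :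
    extendZero k (fun j => β j) = β := by
  ext j
  by_cases h : j = k
  · simp [extendZero, h, hk]
  · simp [extendZero, h]

end DropCol

/-! ### Linearisation of the statistic and of its bootstrap version. -/

section Statistic

variable {n p : ℕ}

/-- The approximation of the test statistic by a linear functional of the noise, given bounds on the
`ℓ₁` error `m` and the error `m'` of the scale estimate. -/
lemma abs_testStat_sub_le {X : Matrix (Fin n) (Fin p) ℝ} {k : Fin p}
    {psi : {j : Fin p // j ≠ k} → ℝ} {theta : (Fin n → ℝ) → ({j : Fin p // j ≠ k} → ℝ)}
    {lam B δ m m' c : ℝ} {b : {j : Fin p // j ≠ k} → ℝ} {e y : Fin n → ℝ}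
    (hn : n ≠ 0) (hlam : 0 ≤ lam) (hB : 0 ≤ B) (hc : 0 < c) (hm : 0 ≤ m)
    (hpsi : IsSqrtLasso (dropCol X k) (B * lam) (X.col k) psi) (hW : nodewiseResid X k psi ≠ 0)
    (hy : y = dropCol X k *ᵥ b + c • e)
    (he : |l2 e / √(n : ℝ) - 1| ≤ δ)
    (h1 : lam * l1 (theta y - b) ≤ m * (l2 (c • e) / √(n : ℝ)))
    (h2 : |l2 (y - dropCol X k *ᵥ theta y) / √(n : ℝ) - l2 (c • e) / √(n : ℝ)| ≤
      m' * (l2 (c • e) / √(n : ℝ))) (hm' : 0 ≤ m') (hsmall : δ + 2 * m' ≤ 1 / 2) :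
    |testStat X k psi theta y -
      nodewiseResid X k psi ⬝ᵥ e / l2 (nodewiseResid X k psi)| ≤
      2 * (δ + 2 * m') * |nodewiseResid X k psi ⬝ᵥ e / l2 (nodewiseResid X k psi)| +
        4 * B * (√(n : ℝ) * m) := by
  set M := dropCol X k with hM
  set W := nodewiseResid X k psi with hWdef
  have hn0 : (0 : ℝ) < √(n : ℝ) := Real.sqrt_pos.2 (by positivity)
  have hW0 : 0 < l2 W := l2_pos hW
  rw [l2_smul, abs_of_pos hc, mul_div_assoc] at h1 h2
  set E := l2 e / √(n : ℝ) with hE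
  set Q' := l2 (y - M *ᵥ theta y) / √(n : ℝ) with hQ'
  set u := theta y - b with hu
  set Z := W ⬝ᵥ e / l2 W with hZ
  have hE2 := abs_le.1 he
  have hE0 : 0 ≤ E := div_nonneg (l2_nonneg _) hn0.le
  have hδ0 : 0 ≤ δ := (abs_nonneg _).trans he
  have hcE : c * E ≤ 2 * c := by nlinarith
  have hQc : |Q' - c| ≤ c * (δ + 2 * m') := by
    have e1 : |c * E - c| ≤ c * δ := by
      have : c * E - c = c * (E - 1) := by ring
      rw [this, abs_mul, abs_of_pos hc]
      exact mul_le_mul_of_nonneg_left he hc.le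
    have e2 := abs_sub_le Q' (c * E) c
    have e3 := mul_le_mul_of_nonneg_left hcE hm'
    linarith
  have hQlow : c / 2 ≤ Q' := by
    have := (abs_le.1 hQc).1
    have := mul_le_mul_of_nonneg_left hsmall hc.le
    linarith
  have hQ0 : 0 < Q' := by linarith
  have hres : y - M *ᵥ theta y = c • e - M *ᵥ u := by
    rw [hu, Matrix.mulVec_sub, hy]; abel
  have hT : testStat X k psi theta y = (c * Z - W ⬝ᵥ (M *ᵥ u) / l2 W) / Q' := by
    have : testStat X k psi theta y = W ⬝ᵥ (y - M *ᵥ theta y) / (l2 W * Q') := by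
      rw [testStat, hQ', mul_div_assoc]
    rw [this, hres, dotProduct_sub, dotProduct_smul, smul_eq_mul, hZ]
    field_simp
  have hbias : |W ⬝ᵥ (M *ᵥ u) / l2 W| ≤ 2 * c * B * (√(n : ℝ) * m) := by
    have hk := fun w => hpsi.dotProduct_resid_le hn (mul_nonneg hB hlam) w
    have hk1 : |W ⬝ᵥ (M *ᵥ u)| ≤ B * lam * √(n : ℝ) * l2 W * l1 u := by
      refine abs_le'.2 ⟨hk u, ?_⟩
      have := hk (-u)
      rwa [Matrix.mulVec_neg, dotProduct_neg, l1_neg] at this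
    rw [abs_div, abs_of_pos hW0, div_le_iff₀ hW0]
    have e1 : lam * l1 u ≤ m * (2 * c) := h1.trans (mul_le_mul_of_nonneg_left hcE hm)
    have e2 := mul_le_mul_of_nonneg_left e1 (by positivity : 0 ≤ B * √(n : ℝ) * l2 W)
    linarith
  -- Splits the error into a relative scale error multiplying `Z` and the bias, over a denominator
  -- at least `c / 2`.
  have hdiff : testStat X k psi theta y - Z =
      ((c - Q') * Z - W ⬝ᵥ (M *ᵥ u) / l2 W) / Q' := by
    rw [hT]; field_simp; ring
  rw [hdiff, abs_div, abs_of_pos hQ0, div_le_iff₀ hQ0]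
  have e1 := abs_sub ((c - Q') * Z) (W ⬝ᵥ (M *ᵥ u) / l2 W)
  rw [abs_mul, abs_sub_comm c] at e1
  have e2 := mul_le_mul_of_nonneg_right hQc (abs_nonneg Z)
  have e3 : 0 ≤ 2 * (δ + 2 * m') * |Z| + 4 * B * (√(n : ℝ) * m) := by positivity
  have e4 := mul_le_mul_of_nonneg_left hQlow e3
  linarith

/-- The event on which the noise `e` has nearly unit scale and obeys the noise bound. -/
def goodNoise (X : Matrix (Fin n) (Fin p) ℝ) (τ a δ : ℝ) : Set (Fin n → ℝ) :=
  {e | |l2 e / √(n : ℝ) - 1| ≤ δ ∧ NoiseBound X τ a e}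

/-- For noise vectors in the good event, the test statistic and its bootstrap version are uniformly
close to a standardised linear functional of the noise. -/
theorem exists_closeness {θ ξ B δ₀ : ℝ} (hθ0 : 0 ≤ θ) (hθ1 : θ < 1) (hξ : 1 + θ < ξ * (1 - θ))
    (hB : 0 ≤ B) (hδ₀ : 0 < δ₀) :
    ∃ δ ω : ℝ, 0 < δ ∧ δ ≤ 1 / 8 ∧ 0 < ω ∧ ∀ {n p : ℕ} (X : Matrix (Fin n) (Fin p) ℝ)
      (S : Finset (Fin p)) (lam ρ a σ : ℝ) (k : Fin p) (psi : {j : Fin p // j ≠ k} → ℝ)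
      (theta : (Fin n → ℝ) → ({j : Fin p // j ≠ k} → ℝ)) (bhat : (Fin n → ℝ) → (Fin p → ℝ))
      (β : Fin p → ℝ) (e : Fin n → ℝ), n ≠ 0 → 0 ≤ lam → 0 ≤ ρ → 0 ≤ a → 0 < σ → k ∉ S →
      √(n : ℝ) * (ρ + a ^ 2) ≤ ω → CompatBound X S ξ lam ρ →
      IsSqrtLasso (dropCol X k) (B * lam) (X.col k) psi → nodewiseResid X k psi ≠ 0 →
      (∀ y, IsSqrtLasso (dropCol X k) lam y (theta y)) →
      (∀ y, IsSqrtLasso X lam y (bhat y)) → β ∈ supportedOn S →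
      e ∈ goodNoise X (θ * lam) a δ →
      |testStat X k psi theta (response X β σ e) -
          nodewiseResid X k psi ⬝ᵥ e / l2 (nodewiseResid X k psi)| ≤
        δ₀ * (1 + |nodewiseResid X k psi ⬝ᵥ e / l2 (nodewiseResid X k psi)|) ∧
      ∀ e' ∈ goodNoise X (θ * lam) a δ,
        |testStat X k psi theta (bootResponse X k theta bhat (response X β σ e) e') -
          nodewiseResid X k psi ⬝ᵥ e' / l2 (nodewiseResid X k psi)| ≤
        δ₀ * (1 + |nodewiseResid X k psi ⬝ᵥ e' / l2 (nodewiseResid X k psi)|) := by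
  obtain ⟨C, hC, H⟩ := exists_const_sqrtLasso hθ0 hθ1 hξ
  -- The bootstrap target has `d = 4 C w`, so its oracle bound is `C (w + 4 C w) = D w`.
  set D := C * (1 + 4 * C) with hD
  have hCD : C ≤ D := by rw [hD]; nlinarith
  have hD0 : 0 < D := by positivity
  set δ := min (1 / 8) (δ₀ / 8) with hδ
  -- The four bounds serve, in turn, the hypothesis `ρ ≤ 1 / 16`, the bounds `d ≤ 1` and `δ + 2 m' ≤
  -- 1 / 2`, the scale error, and the bias.
  set ω := min (min (1 / 16) (1 / (16 * (D + 1)))) (min (δ₀ / (32 * (D + 1)))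
    (δ₀ / (4 * (B + 1) * D))) with hω
  have hδpos : 0 < δ := by positivity
  have hδ1 : δ ≤ 1 / 8 := min_le_left _ _
  have hδ2 : δ ≤ δ₀ / 8 := min_le_right _ _
  have hωpos : 0 < ω := by positivity
  have hω1 : ω ≤ 1 / 16 := (min_le_left _ _).trans (min_le_left _ _)
  have hω2 : (D + 1) * ω ≤ 1 / 16 := by
    have : ω ≤ 1 / (16 * (D + 1)) := (min_le_left _ _).trans (min_le_right _ _)
    rw [le_div_iff₀ (by positivity)] at this
    linarith
  have hω3 : (D + 1) * ω ≤ δ₀ / 32 := by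
    have : ω ≤ δ₀ / (32 * (D + 1)) := (min_le_right _ _).trans (min_le_left _ _)
    rw [le_div_iff₀ (by positivity)] at this
    linarith
  have hω4 : 4 * B * (D * ω) ≤ δ₀ := by
    have : ω ≤ δ₀ / (4 * (B + 1) * D) := (min_le_right _ _).trans (min_le_right _ _)
    rw [le_div_iff₀ (by positivity)] at this
    have : 0 ≤ D * ω := by positivity
    linarith
  refine ⟨δ, ω, hδpos, hδ1, hωpos, ?_⟩
  intro n p X S lam ρ a σ k psi theta bhat β e hn hlam hρ ha hσ hk hsmall hcomp hpsi hW htheta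
    hbhat hβ he
  set w := ρ + a ^ 2 with hw
  have hw0 : 0 ≤ w := by positivity
  have hn1 : 1 ≤ √(n : ℝ) := Real.one_le_sqrt.2 (by exact_mod_cast Nat.one_le_iff_ne_zero.2 hn)
  have hnpos : 0 < √(n : ℝ) := by linarith
  have hwω : w ≤ ω := by nlinarith
  have ha2 : 0 ≤ a ^ 2 := sq_nonneg a
  have hρ1 : ρ ≤ 1 / 16 := by linarith
  have hDw : (D + 1) * w ≤ (D + 1) * ω := mul_le_mul_of_nonneg_left hwω (by positivity)
  have hne : ∀ {e : Fin n → ℝ}, e ∈ goodNoise X (θ * lam) a δ → e ≠ 0 := by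
    rintro e ⟨he, -⟩ rfl
    have h0 : l2 (0 : Fin n → ℝ) = 0 := l2_eq_zero.2 rfl
    rw [h0, zero_div, zero_sub, abs_neg, abs_one] at he
    linarith
  -- closeness for an arbitrary approximately sparse target
  have main : ∀ (c d : ℝ) (b : {j : Fin p // j ≠ k} → ℝ) (e : Fin n → ℝ), 0 < c → 0 ≤ d →
      d ≤ 4 * C * w → e ∈ goodNoise X (θ * lam) a δ →
      lam * ∑ j ∈ (S.subtype (· ≠ k))ᶜ, |b j| ≤ d * (l2 (c • e) / √(n : ℝ)) →
      lam * l1 (theta (dropCol X k *ᵥ b + c • e) - b) ≤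
        C * (ρ + d + a ^ 2) * (l2 (c • e) / √(n : ℝ)) ∧
      |testStat X k psi theta (dropCol X k *ᵥ b + c • e) -
        nodewiseResid X k psi ⬝ᵥ e / l2 (nodewiseResid X k psi)| ≤
      δ₀ * (1 + |nodewiseResid X k psi ⬝ᵥ e / l2 (nodewiseResid X k psi)|) := by
    intro c d b e hc hd hdw he hslack
    have hd1 : d ≤ 1 := by
      have : C * w ≤ D * w := mul_le_mul_of_nonneg_right hCD hw0
      linarith
    have hm : C * (ρ + d + a ^ 2) ≤ D * w := by
      have : C * (ρ + d + a ^ 2) ≤ C * (w + 4 * C * w) :=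
        mul_le_mul_of_nonneg_left (by linarith) hC.le
      calc _ ≤ _ := this
        _ = D * w := by rw [hD]; ring
    obtain ⟨h1, h2⟩ := H (dropCol X k) (S.subtype (· ≠ k)) lam ρ d a b
      (theta (dropCol X k *ᵥ b + c • e)) (c • e) hn (smul_ne_zero hc.ne' (hne he)) hlam hρ hd ha
      hd1 hρ1 (htheta _) ((he.2.dropCol k).smul hc) (hcomp.dropCol k) hslack
    refine ⟨h1, ?_⟩
    have hm0 : 0 ≤ C * (ρ + d + a ^ 2) := by positivity
    have h3 := abs_testStat_sub_le (m := C * (ρ + d + a ^ 2))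
      (m' := C * (ρ + d + a ^ 2) + a ^ 2) hn hlam hB hc hm0 hpsi hW rfl he.1 h1 h2
      (by positivity) (by linarith)
    refine h3.trans ?_
    set Z := |nodewiseResid X k psi ⬝ᵥ e / l2 (nodewiseResid X k psi)| with hZ
    have hZ0 : 0 ≤ Z := abs_nonneg _
    have e1 : 2 * (δ + 2 * (C * (ρ + d + a ^ 2) + a ^ 2)) ≤ δ₀ := by linarith
    have e2 : 4 * B * (√(n : ℝ) * (C * (ρ + d + a ^ 2))) ≤ δ₀ := by
      refine le_trans (mul_le_mul_of_nonneg_left ?_ (by positivity)) hω4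
      calc √(n : ℝ) * (C * (ρ + d + a ^ 2)) ≤ √(n : ℝ) * (D * w) :=
            mul_le_mul_of_nonneg_left hm hnpos.le
        _ = D * (√(n : ℝ) * w) := by ring
        _ ≤ D * ω := mul_le_mul_of_nonneg_left hsmall hD0.le
    have e3 := mul_le_mul_of_nonneg_right e1 hZ0
    linarith
  set b₀ : {j : Fin p // j ≠ k} → ℝ := fun j => β j with hb₀
  have hy : response X β σ e = dropCol X k *ᵥ b₀ + σ • e := by
    rw [response, ← mulVec_extendZero, hb₀, extendZero_restrict (hβ k hk)]
  have hb₀S : ∑ j ∈ (S.subtype (· ≠ k))ᶜ, |b₀ j| = 0 :=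
    Finset.sum_eq_zero fun j hj => by
      rw [hb₀, abs_eq_zero]
      refine hβ _ fun hjS => ?_
      simp [hjS] at hj
  obtain ⟨hl, hT⟩ := main σ 0 b₀ e hσ le_rfl (by positivity) he (by rw [hb₀S]; simp)
  rw [← hy] at hl hT
  refine ⟨hT, fun e' he' => ?_⟩
  set y := response X β σ e with hydef
  have hβS : ∑ j ∈ Sᶜ, |β j| = 0 :=
    Finset.sum_eq_zero fun j hj => by rw [abs_eq_zero]; exact hβ _ (Finset.mem_compl.1 hj)
  -- The full regression has an exactly sparse target; its scale bound keeps `sigmaCheck` positive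
  -- and comparable with the noise level.
  obtain ⟨-, hs⟩ := H X S lam ρ 0 a β (bhat y) (σ • e) hn (smul_ne_zero hσ.ne' (hne he)) hlam hρ
    le_rfl ha zero_le_one hρ1 (hbhat y) (he.2.smul hσ) hcomp (by rw [hβS]; simp)
  have hs' : |sigmaCheck X bhat y - l2 (σ • e) / √(n : ℝ)| ≤
      (C * (ρ + 0 + a ^ 2) + a ^ 2) * (l2 (σ • e) / √(n : ℝ)) := hs
  rw [add_zero, ← hw] at hs' hl
  set Q := l2 (σ • e) / √(n : ℝ) with hQ
  have hQ0 : 0 < Q := div_pos (l2_pos (smul_ne_zero hσ.ne' (hne he))) hnpos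
  have hsQ : 3 / 4 * Q ≤ sigmaCheck X bhat y := by
    have h1 := (abs_le.1 hs').1
    have h2 : C * w + a ^ 2 ≤ 1 / 4 := by
      have : C * w ≤ D * w := mul_le_mul_of_nonneg_right hCD hw0
      linarith
    have := mul_le_mul_of_nonneg_right h2 hQ0.le
    linarith
  have hs0 : 0 < sigmaCheck X bhat y := by linarith
  refine (main (sigmaCheck X bhat y) (4 * C * w) (theta y) e' hs0 (by positivity) le_rfl he' ?_).2
  have hE' : 7 / 8 ≤ l2 e' / √(n : ℝ) := by linarith [(abs_le.1 he'.1).1]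
  -- The bootstrap noise level is at least `3 / 4 * 7 / 8` times the original one; the factor 4 is
  -- generous.
  have hQ' : Q ≤ 4 * (l2 (sigmaCheck X bhat y • e') / √(n : ℝ)) := by
    rw [l2_smul, abs_of_pos hs0, mul_div_assoc]
    have := mul_le_mul_of_nonneg_left hE' hs0.le
    linarith
  calc lam * ∑ j ∈ (S.subtype (· ≠ k))ᶜ, |theta y j|
      = lam * ∑ j ∈ (S.subtype (· ≠ k))ᶜ, |(theta y - b₀) j| := by
        congr 1
        refine Finset.sum_congr rfl fun j hj => ?_
        have : b₀ j = 0 := by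
          have := (Finset.sum_eq_zero_iff_of_nonneg fun j _ => abs_nonneg (b₀ j)).1 hb₀S j hj
          exact abs_eq_zero.1 this
        simp [this]
    _ ≤ lam * l1 (theta y - b₀) :=
        mul_le_mul_of_nonneg_left (Finset.sum_le_sum_of_subset_of_nonneg (Finset.subset_univ _)
          fun _ _ _ => abs_nonneg _) hlam
    _ ≤ C * w * Q := hl
    _ ≤ C * w * (4 * (l2 (sigmaCheck X bhat y • e') / √(n : ℝ))) :=
        mul_le_mul_of_nonneg_left hQ' (by positivity)
    _ = _ := by ring

end Statistic

/-! ### Gaussian tails, norm concentration and comparison with `Phi`. -/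

section Gaussian

variable {n : ℕ}

instance isProbabilityMeasure_stdNormal : IsProbabilityMeasure (stdNormal n) := by
  unfold stdNormal; infer_instance

lemma measurable_dotProduct (a : Fin n → ℝ) : Measurable fun e : Fin n → ℝ => a ⬝ᵥ e := by
  unfold dotProduct; fun_prop

lemma map_dotProduct_stdNormal {a : Fin n → ℝ} (ha : l2 a = 1) :
    (stdNormal n).map (fun e => a ⬝ᵥ e) = gaussianReal 0 1 := by
  set L : StrongDual ℝ (EuclideanSpace ℝ (Fin n)) := innerSL ℝ (WithLp.toLp 2 a) with hL
  have hcomp : (fun e : Fin n → ℝ => a ⬝ᵥ e) = L ∘ WithLp.toLp 2 := by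
    ext e
    simp [hL, EuclideanSpace.inner_toLp_toLp, dotProduct_comm]
  have hnorm : ‖L‖ = 1 := by rw [hL, innerSL_apply_norm]; exact ha
  rw [hcomp, ← Measure.map_map (by fun_prop) (by fun_prop), stdNormal, map_pi_eq_stdGaussian,
    IsGaussian.map_eq_gaussianReal, integral_strongDual_stdGaussian, variance_dual_stdGaussian,
    hnorm]
  simp

lemma gaussianReal_real_abs_ge_le (t : ℝ) (ht : 0 ≤ t) :
    (gaussianReal 0 1).real {x | t ≤ |x|} ≤ 2 * Real.exp (-t ^ 2 / 2) := by
  have h1 : (gaussianReal 0 1).real {x | t ≤ x} ≤ Real.exp (-t ^ 2 / 2) := by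
    have h := measure_ge_le_exp_mul_mgf (μ := gaussianReal 0 1) (X := id) t ht
      (integrable_exp_mul_gaussianReal t)
    rw [mgf_id_gaussianReal, ← Real.exp_add] at h
    refine h.trans (le_of_eq ?_)
    congr 1
    simp; ring
  have h2 : (gaussianReal 0 1).real {x | x ≤ -t} ≤ Real.exp (-t ^ 2 / 2) := by
    have h := measure_le_le_exp_mul_mgf (μ := gaussianReal 0 1) (X := id) (t := -t) (-t)
      (by linarith) (integrable_exp_mul_gaussianReal (-t))
    rw [mgf_id_gaussianReal, ← Real.exp_add] at h
    refine h.trans (le_of_eq ?_)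
    congr 1
    simp; ring
  have h3 : {x : ℝ | t ≤ |x|} = {x | t ≤ x} ∪ {x | x ≤ -t} := by
    ext x
    simp [le_abs, le_neg]
  rw [h3]
  linarith [measureReal_union_le (μ := gaussianReal 0 1) {x | t ≤ x} {x | x ≤ -t}]

lemma stdNormal_real_abs_dotProduct_ge_le {a : Fin n → ℝ} (ha : l2 a = 1) {t : ℝ} (ht : 0 ≤ t) :
    (stdNormal n).real {e | t ≤ |a ⬝ᵥ e|} ≤ 2 * Real.exp (-t ^ 2 / 2) := by
  have h := gaussianReal_real_abs_ge_le t ht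
  rwa [← map_dotProduct_stdNormal ha, map_measureReal_apply (measurable_dotProduct a)
    (measurableSet_le measurable_const (by fun_prop))] at h

lemma integral_sq_gaussianReal : ∫ x, x ^ 2 ∂(gaussianReal 0 1) = 1 := by
  have h := variance_fun_id_gaussianReal (μ := 0) (v := 1)
  rw [variance_of_integral_eq_zero (by fun_prop) (by simp)] at h
  simpa using h

lemma memLp_sq_gaussianReal : MemLp (fun x : ℝ => x ^ 2) 2 (gaussianReal 0 1) := by
  have h := memLp_id_gaussianReal' (μ := 0) (v := 1) 4 (by simp)
  have h2 := h.norm_rpow_div (q := 2)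
  have h3 : (4 : ℝ≥0∞) / 2 = 2 := by
    rw [show (4 : ℝ≥0∞) = 2 * 2 by norm_num]
    exact ENNReal.mul_div_cancel_right (by simp) (by simp)
  rw [h3] at h2
  simpa using h2

lemma integrable_sq_gaussianReal : Integrable (fun x : ℝ => x ^ 2) (gaussianReal 0 1) :=
  memLp_sq_gaussianReal.integrable (by simp)

lemma integrable_dotProduct_sq {a : Fin n → ℝ} (ha : l2 a = 1) :
    Integrable (fun e => (a ⬝ᵥ e) ^ 2) (stdNormal n) := by
  have h := integrable_sq_gaussianReal
  rw [← map_dotProduct_stdNormal ha] at h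
  exact h.comp_measurable (measurable_dotProduct a)

lemma integral_dotProduct_sq {a : Fin n → ℝ} (ha : l2 a = 1) :
    ∫ e, (a ⬝ᵥ e) ^ 2 ∂(stdNormal n) = 1 := by
  have h := integral_sq_gaussianReal
  rwa [← map_dotProduct_stdNormal ha,
    integral_map (measurable_dotProduct a).aemeasurable (by fun_prop)] at h

/-- Concentration of the norm of a standard normal vector. -/
lemma exists_stdNormal_norm_bound :
    ∃ v : ℝ, ∀ (n : ℕ) (δ : ℝ), n ≠ 0 → 0 < δ →
      (stdNormal n).real {e | ¬ |l2 e / √(n : ℝ) - 1| ≤ δ} ≤ v / (n * δ ^ 2) := by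
  refine ⟨Var[fun x : ℝ => x ^ 2; gaussianReal 0 1], fun n δ hn hδ => ?_⟩
  have hn0 : (0 : ℝ) < n := by positivity
  set Y : (Fin n → ℝ) → ℝ := ∑ i : Fin n, fun e => e i ^ 2 with hY
  have hYe : ∀ e, Y e = l2 e ^ 2 := by
    intro e
    rw [l2_sq, hY, Finset.sum_apply]
    exact Finset.sum_congr rfl fun i _ => sq _
  have hi : ∀ i : Fin n, MemLp (fun e : Fin n → ℝ => e i ^ 2) 2 (stdNormal n) := fun i =>
    memLp_sq_gaussianReal.comp_measurePreserving
      (measurePreserving_eval (fun _ : Fin n => gaussianReal 0 1) i)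
  have hmem : MemLp Y 2 (stdNormal n) := memLp_finsetSum' _ fun i _ => hi i
  have hvar : Var[Y; stdNormal n] = n * Var[fun x : ℝ => x ^ 2; gaussianReal 0 1] := by
    have := variance_sum_pi (μ := fun _ : Fin n => gaussianReal 0 1)
      (X := fun _ x => x ^ 2) fun _ => memLp_sq_gaussianReal
    rw [hY, stdNormal, this]
    simp
  have hmean : ∫ e, Y e ∂(stdNormal n) = n := by
    simp only [hY, Finset.sum_apply]
    rw [integral_finsetSum _ fun i _ => (hi i).integrable (by simp)]
    have : ∀ i : Fin n, ∫ e, e i ^ 2 ∂(stdNormal n) = 1 := fun i => by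
      rw [← integral_sq_gaussianReal]
      exact integral_comp_eval (μ := fun _ : Fin n => gaussianReal 0 1) (f := fun x : ℝ => x ^ 2)
        (by fun_prop)
    simp [this]
  -- Chebyshev for `‖e‖²`; the passage to `‖e‖ / √n = q` uses `|q² - 1| ≥ |q - 1|`.
  have hch := meas_ge_le_variance_div_sq hmem (mul_pos hn0 hδ)
  rw [hmean, hvar] at hch
  have hv : 0 ≤ Var[fun x : ℝ => x ^ 2; gaussianReal 0 1] := variance_nonneg _ _
  have hch' := ENNReal.toReal_le_of_le_ofReal (by positivity) hch
  refine (measureReal_mono ?_).trans (hch'.trans (le_of_eq ?_))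
  · intro e he
    simp only [Set.mem_ofPred_eq, not_le] at he ⊢
    rw [hYe]
    set q := l2 e / √(n : ℝ) with hq
    have hq0 : 0 ≤ q := div_nonneg (l2_nonneg _) (by positivity)
    have hnn : √(n : ℝ) ^ 2 = n := Real.sq_sqrt hn0.le
    have : l2 e ^ 2 = n * q ^ 2 := by
      rw [hq, div_pow, hnn]; field_simp
    have e1 : l2 e ^ 2 - n = n * ((q + 1) * (q - 1)) := by rw [this]; ring
    rw [e1, abs_mul, abs_mul, abs_of_pos hn0, abs_of_pos (by linarith : 0 < q + 1)]
    refine mul_le_mul_of_nonneg_left ?_ hn0.le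
    nlinarith [abs_nonneg (q - 1)]
  · field_simp

/-- The normal density is at most 1, a crude but sufficient Lipschitz constant. -/
lemma Phi_sub_le {x t : ℝ} (ht : 0 ≤ t) : Phi (x + t) ≤ Phi x + t := by
  simp only [Phi, cdf_eq_real]
  have h1 : Set.Iic (x + t) = Set.Iic x ∪ Set.Ioc x (x + t) :=
    (Set.Iic_union_Ioc_eq_Iic (by linarith)).symm
  have h2 : (gaussianReal 0 1).real (Set.Ioc x (x + t)) ≤ t := by
    refine ENNReal.toReal_le_of_le_ofReal ht ?_
    rw [gaussianReal_apply _ one_ne_zero]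
    calc ∫⁻ y in Set.Ioc x (x + t), gaussianPDF 0 1 y
        ≤ ∫⁻ y in Set.Ioc x (x + t), 1 := by
          refine lintegral_mono fun y => ?_
          rw [gaussianPDF, ENNReal.ofReal_le_one, gaussianPDFReal]
          refine mul_le_one₀ ?_ (Real.exp_nonneg _) ?_
          · refine inv_le_one_of_one_le₀ (Real.one_le_sqrt.2 ?_)
            have := Real.pi_gt_three
            simp only [NNReal.coe_one]; linarith
          · rw [Real.exp_le_one_iff]
            have := sq_nonneg (y - 0)
            simp only [NNReal.coe_one]; linarith
      _ = ENNReal.ofReal t := by simp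
  rw [h1]
  exact (measureReal_union_le _ _).trans (by linarith)

/-- A statistic close to a standard normal variable on a large set has nearly normal distribution
function; the statistic and the set need not be measurable. -/
lemma abs_measureReal_sub_Phi_le {Ω : Type*} [MeasurableSpace Ω] {μ : Measure Ω}
    [IsProbabilityMeasure μ] {Z T : Ω → ℝ} {G : Set Ω} {η δ K : ℝ} (hZ : Measurable Z)
    (hlaw : μ.map Z = gaussianReal 0 1) (hG : μ.real Gᶜ ≤ η)
    (hK : (gaussianReal 0 1).real {x | K ≤ |x|} ≤ η) (hK0 : 0 ≤ K) (hδ : 0 ≤ δ)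
    (hclose : ∀ e ∈ G, |T e - Z e| ≤ δ * (1 + |Z e|)) (x : ℝ) :
    |μ.real {e | T e ≤ x} - Phi x| ≤ 2 * η + δ * (1 + K) := by
  set t := δ * (1 + K) with ht
  have ht0 : 0 ≤ t := by positivity
  have hPhi : ∀ y, Phi y = μ.real {e | Z e ≤ y} := fun y => by
    rw [Phi, cdf_eq_real, ← hlaw, map_measureReal_apply hZ measurableSet_Iic]; rfl
  have hKZ : μ.real {e | K ≤ |Z e|} ≤ η := by
    rwa [← hlaw, map_measureReal_apply hZ (measurableSet_le measurable_const (by fun_prop))] at hK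
  have hgood : ∀ e ∈ G, ¬ K ≤ |Z e| → |T e - Z e| ≤ t := fun e he hKe =>
    (hclose e he).trans (mul_le_mul_of_nonneg_left (by linarith) hδ)
  -- Only inclusions of sets are used, so neither `G` nor the events of `T` need be measurable. The
  -- two applications sandwich `T ≤ x` between `Z ≤ x - t` and `Z ≤ x + t`.
  have hbound : ∀ A B : Set Ω, (∀ e ∈ A, e ∈ G → ¬ K ≤ |Z e| → e ∈ B) →
      μ.real A ≤ μ.real B + 2 * η := by
    intro A B h
    have hsub : A ⊆ B ∪ (Gᶜ ∪ {e | K ≤ |Z e|}) := by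
      intro e he
      by_cases h1 : e ∈ G
      · by_cases h2 : K ≤ |Z e|
        · exact Or.inr (Or.inr h2)
        · exact Or.inl (h e he h1 h2)
      · exact Or.inr (Or.inl h1)
    have h1 := measureReal_mono (μ := μ) hsub
    have h2 := measureReal_union_le (μ := μ) B (Gᶜ ∪ {e | K ≤ |Z e|})
    have h3 := measureReal_union_le (μ := μ) Gᶜ {e | K ≤ |Z e|}
    linarith
  refine abs_le.2 ⟨?_, ?_⟩
  · have h1 := hbound {e | Z e ≤ x - t} {e | T e ≤ x} fun e he h1 h2 => by
      have := (abs_le.1 (hgood e h1 h2)).2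
      simp only [Set.mem_ofPred_eq] at he ⊢; linarith
    rw [← hPhi] at h1
    have h2 := Phi_sub_le (x := x - t) ht0
    rw [sub_add_cancel] at h2
    linarith
  · have h1 := hbound {e | T e ≤ x} {e | Z e ≤ x + t} fun e he h1 h2 => by
      have := (abs_le.1 (hgood e h1 h2)).1
      simp only [Set.mem_ofPred_eq] at he ⊢; linarith
    rw [← hPhi] at h1
    linarith [Phi_sub_le (x := x) ht0]

end Gaussian

/-! ### Probability of the noise event. -/

section GoodNoise

variable {n p : ℕ}

lemma dotProduct_mulVec_le_of_abs_le {X : Matrix (Fin n) (Fin p) ℝ} {e : Fin n → ℝ} {c : ℝ}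
    (h : ∀ j, |X.col j ⬝ᵥ e| ≤ c) (u : Fin p → ℝ) : e ⬝ᵥ (X *ᵥ u) ≤ c * l1 u := by
  have h1 : e ⬝ᵥ (X *ᵥ u) = ∑ j, (X.col j ⬝ᵥ e) * u j := by
    rw [Matrix.dotProduct_mulVec]
    refine Finset.sum_congr rfl fun j _ => ?_
    rw [dotProduct_comm]; rfl
  rw [h1, l1, Finset.mul_sum]
  refine Finset.sum_le_sum fun j _ => (le_abs_self _).trans ?_
  rw [abs_mul]
  exact mul_le_mul_of_nonneg_right (h j) (abs_nonneg _)

/-- All the columns of a large scaled design are nearly uncorrelated with Gaussian noise. -/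
lemma stdNormal_real_exists_col_le (X : Matrix (Fin n) (Fin p) ℝ) (hn : n ≠ 0)
    (hX : ∀ k, l2 (X.col k) = √(n : ℝ)) {t : ℝ} (ht : 0 ≤ t) :
    (stdNormal n).real {e | ∃ j, t * √(n : ℝ) ≤ |X.col j ⬝ᵥ e|} ≤
      p * (2 * Real.exp (-t ^ 2 / 2)) := by
  have hn0 : (0 : ℝ) < √(n : ℝ) := Real.sqrt_pos.2 (by positivity)
  have h1 : {e | ∃ j, t * √(n : ℝ) ≤ |X.col j ⬝ᵥ e|} =
      ⋃ j, {e | t * √(n : ℝ) ≤ |X.col j ⬝ᵥ e|} := by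
    ext e; simp
  rw [h1]
  refine (measureReal_iUnion_fintype_le _).trans ?_
  have h2 : ∀ j, (stdNormal n).real {e | t * √(n : ℝ) ≤ |X.col j ⬝ᵥ e|} ≤
      2 * Real.exp (-t ^ 2 / 2) := by
    intro j
    have hu : l2 ((√(n : ℝ))⁻¹ • X.col j) = 1 := by
      rw [l2_smul, hX, abs_of_pos (inv_pos.2 hn0), inv_mul_cancel₀ hn0.ne']
    refine le_trans (le_of_eq ?_) (stdNormal_real_abs_dotProduct_ge_le hu ht)
    congr 1
    ext e
    simp only [Set.mem_ofPred_eq, smul_dotProduct, smul_eq_mul, abs_mul,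
      abs_of_pos (inv_pos.2 hn0)]
    rw [inv_mul_eq_div, le_div_iff₀ hn0]
  calc _ ≤ ∑ _j : Fin p, 2 * Real.exp (-t ^ 2 / 2) := Finset.sum_le_sum fun j _ => h2 j
    _ = _ := by simp

/-- The projection of Gaussian noise on the column space of a design with `p` columns has squared
norm of order `p`. -/
lemma stdNormal_real_not_proj_le (X : Matrix (Fin n) (Fin p) ℝ) {K : ℝ} (hK : 0 < K) :
    (stdNormal n).real {e | ¬ ∀ u, e ⬝ᵥ (X *ᵥ u) ≤ √K * l2 (X *ᵥ u)} ≤ p / K := by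
  set V : Submodule ℝ (EuclideanSpace ℝ (Fin n)) :=
    Submodule.span ℝ (Set.range fun j => WithLp.toLp 2 (X.col j)) with hV
  have hdim : Module.finrank ℝ V ≤ p := by
    have := finrank_range_le_card (R := ℝ) fun j => WithLp.toLp 2 (X.col j)
    rwa [Fintype.card_fin] at this
  have hmem : ∀ u, WithLp.toLp 2 (X *ᵥ u) ∈ V := by
    intro u
    rw [Matrix.mulVec_eq_sum, WithLp.toLp_sum]
    refine Submodule.sum_mem _ fun j _ => ?_
    have : WithLp.toLp 2 (MulOpposite.op (u j) • Xᵀ j) = u j • WithLp.toLp 2 (X.col j) := by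
      ext i; simp [mul_comm]
    rw [this]
    exact V.smul_mem _ (Submodule.subset_span ⟨j, rfl⟩)
  set v := stdOrthonormalBasis ℝ V with hv
  -- The squared norm of the projection of `e` on the column space: its mean is the dimension, at
  -- most `p`, and Markov's inequality applies.
  set f : (Fin n → ℝ) → ℝ := fun e => ∑ i, (WithLp.ofLp (v i : EuclideanSpace ℝ (Fin n)) ⬝ᵥ e) ^ 2
    with hf
  have hv1 : ∀ i, l2 (WithLp.ofLp (v i : EuclideanSpace ℝ (Fin n))) = 1 := fun i =>
    v.orthonormal.1 i
  have hint : Integrable f (stdNormal n) :=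
    integrable_finsetSum _ fun i _ => integrable_dotProduct_sq (hv1 i)
  have hmean : ∫ e, f e ∂(stdNormal n) ≤ p := by
    rw [hf, integral_finsetSum _ fun i _ => integrable_dotProduct_sq (hv1 i)]
    simp only [integral_dotProduct_sq (hv1 _)]
    simpa using hdim
  have hf0 : ∀ e, 0 ≤ f e := fun e => Finset.sum_nonneg fun i _ => sq_nonneg _
  have hmk := mul_meas_ge_le_integral_of_nonneg (ae_of_all _ hf0) hint K
  have hsub : {e | ¬ ∀ u, e ⬝ᵥ (X *ᵥ u) ≤ √K * l2 (X *ᵥ u)} ⊆ {e | K ≤ f e} := by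
    intro e he
    simp only [Set.mem_ofPred_eq] at he ⊢
    by_contra! hlt
    refine he fun u => ?_
    set z : V := ⟨WithLp.toLp 2 (X *ᵥ u), hmem u⟩ with hz
    set P : V := ∑ i, (WithLp.ofLp (v i : EuclideanSpace ℝ (Fin n)) ⬝ᵥ e) • v i with hP
    have hPn : ‖P‖ ^ 2 = f e := by
      rw [← v.sum_sq_inner_right P, hf]
      refine Finset.sum_congr rfl fun i _ => ?_
      rw [hP, v.orthonormal.inner_right_fintype]
    have hin : e ⬝ᵥ (X *ᵥ u) = inner ℝ P z := by
      have h1 : (z : EuclideanSpace ℝ (Fin n)) =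
          ∑ i, inner ℝ (v i) z • (v i : EuclideanSpace ℝ (Fin n)) := by
        conv_lhs => rw [← v.sum_repr' z]
        simp
      have h2 : e ⬝ᵥ (X *ᵥ u) = inner ℝ (WithLp.toLp 2 e) (z : EuclideanSpace ℝ (Fin n)) := by
        rw [hz, EuclideanSpace.inner_toLp_toLp, dotProduct_comm]; simp
      rw [h2, h1, inner_sum, hP, sum_inner]
      refine Finset.sum_congr rfl fun i _ => ?_
      have hl : ∀ c : ℝ, inner ℝ (c • v i) z = c * inner ℝ (v i) z := fun c => by
        rw [Submodule.coe_inner, Submodule.coe_inner, Submodule.coe_smul, real_inner_smul_left]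
      rw [real_inner_smul_right, hl]
      have : inner ℝ (WithLp.toLp 2 e) (v i : EuclideanSpace ℝ (Fin n)) =
          WithLp.ofLp (v i : EuclideanSpace ℝ (Fin n)) ⬝ᵥ e := by
        simp [EuclideanSpace.inner_eq_star_dotProduct]
      rw [this]; exact mul_comm _ _
    have hPK : ‖P‖ ≤ √K := Real.le_sqrt_of_sq_le (by rw [hPn]; exact hlt.le)
    rw [hin]
    refine (real_inner_le_norm P z).trans ?_
    exact mul_le_mul_of_nonneg_right hPK (norm_nonneg _)
  refine (measureReal_mono hsub).trans ?_
  rw [le_div_iff₀ hK, mul_comm]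
  exact hmk.trans hmean

lemma measureReal_compl_goodNoise_le_add (X : Matrix (Fin n) (Fin p) ℝ) {τ a δ : ℝ}
    {R : Set (Fin n → ℝ)} (h : ∀ e, |l2 e / √(n : ℝ) - 1| ≤ δ → e ∉ R → NoiseBound X τ a e) :
    (stdNormal n).real (goodNoise X τ a δ)ᶜ ≤
      (stdNormal n).real {e | ¬ |l2 e / √(n : ℝ) - 1| ≤ δ} + (stdNormal n).real R := by
  refine (measureReal_mono ?_).trans (measureReal_union_le _ _)
  intro e he
  by_cases h1 : |l2 e / √(n : ℝ) - 1| ≤ δ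
  · by_cases h2 : e ∈ R
    · exact Or.inr h2
    · exact absurd ⟨h1, h e h1 h2⟩ he
  · exact Or.inl h1

/-- The good noise event has probability close to one, uniformly over the scaled designs with any
number of columns. -/
theorem exists_eventually_goodNoise {A θ δ η : ℝ} (hA : 0 < A) (hθ : 0 < θ) (hAθ : 1 < θ * A)
    (hδ : 0 < δ) (hη : 0 < η) :
    ∃ K : ℝ, 0 ≤ K ∧ ∀ᶠ n : ℕ in atTop, ∀ (p : ℕ) (X : Matrix (Fin n) (Fin p) ℝ),
      (∀ k, l2 (X.col k) = √(n : ℝ)) →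
      (stdNormal n).real (goodNoise X (θ * (A * √(2 * Real.log p / n))) √(K / n) δ)ᶜ ≤ η := by
  obtain ⟨v, hv⟩ := exists_stdNormal_norm_bound
  -- A smaller tolerance, so that `b = θ A (1 - δ')` still exceeds 1 after `‖e‖` is replaced by its
  -- lower bound `(1 - δ') √n`.
  set δ' := min δ (min (1 / 2) ((1 - 1 / (θ * A)) / 2)) with hδ'
  have hθA : 0 < θ * A := by positivity
  have h1 : 0 < 1 - 1 / (θ * A) := by
    rw [sub_pos, div_lt_one hθA]; exact hAθ
  have hδ'0 : 0 < δ' := by positivity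
  have hδ'1 : δ' ≤ δ := min_le_left _ _
  have hδ'2 : δ' ≤ 1 / 2 := (min_le_right _ _).trans (min_le_left _ _)
  have hδ'3 : δ' < 1 - 1 / (θ * A) := by
    have : δ' ≤ (1 - 1 / (θ * A)) / 2 := (min_le_right _ _).trans (min_le_right _ _)
    linarith
  set b := θ * A * (1 - δ') with hb
  have hb1 : 1 < b := by
    have := mul_lt_mul_of_pos_left hδ'3 hθA
    rw [mul_sub, mul_one_div_cancel hθA.ne'] at this
    rw [hb]; linarith
  have hb2 : 1 < b ^ 2 := by nlinarith
  -- This is the union bound over `q` columns at level `b √(2 log q)`; `L` is the number of columns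
  -- beyond which it is below `η / 2`.
  have htail : Tendsto (fun q : ℕ => 2 * (q : ℝ) ^ (-(b ^ 2 - 1))) atTop (𝓝 (2 * 0)) :=
    ((tendsto_rpow_neg_atTop (by linarith)).comp tendsto_natCast_atTop_atTop).const_mul 2
  rw [mul_zero] at htail
  obtain ⟨L, hL⟩ := eventually_atTop.1 (htail.eventually_le_const (by positivity : 0 < η / 2))
  -- `2 (L + 1) / η` is the Markov threshold for at most `L + 1` columns; the factor 4 pays for `‖e‖
  -- ≥ √n / 2`, squared.
  refine ⟨8 * (L + 1) / η, by positivity, ?_⟩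
  have hnorm : Tendsto (fun n : ℕ => v / (n * δ' ^ 2)) atTop (𝓝 0) :=
    tendsto_const_nhds.div_atTop
      (tendsto_natCast_atTop_atTop.atTop_mul_const (by positivity))
  filter_upwards [hnorm.eventually_le_const (by positivity : 0 < η / 2), eventually_ne_atTop 0]
    with n hnη hn p X hX
  have hn0 : (0 : ℝ) < √(n : ℝ) := Real.sqrt_pos.2 (by positivity)
  have hmono : (goodNoise X (θ * (A * √(2 * Real.log p / n))) √(8 * (L + 1) / η / n) δ)ᶜ ⊆
      (goodNoise X (θ * (A * √(2 * Real.log p / n))) √(8 * (L + 1) / η / n) δ')ᶜ :=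
    Set.compl_subset_compl.2 fun e he => ⟨he.1.trans hδ'1, he.2⟩
  refine (measureReal_mono hmono).trans ?_
  have hlow : ∀ e : Fin n → ℝ, |l2 e / √(n : ℝ) - 1| ≤ δ' → (1 - δ') * √(n : ℝ) ≤ l2 e := by
    intro e he
    have := (abs_le.1 he).1
    rw [← le_div_iff₀ hn0]
    linarith
  have hv' := (hv n δ' hn hδ'0).trans hnη
  by_cases hp : max L 2 ≤ p
  · have hp1 : (1 : ℝ) ≤ p := by
      exact_mod_cast (by omega : 1 ≤ p)
    have hlog : 0 ≤ Real.log p := Real.log_nonneg hp1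
    set t := b * √(2 * Real.log p) with ht
    have ht0 : 0 ≤ t := by positivity
    have hsum := measureReal_compl_goodNoise_le_add X
      (τ := θ * (A * √(2 * Real.log p / n))) (a := √(8 * (L + 1) / η / n)) (δ := δ')
      (R := {e | ∃ j, t * √(n : ℝ) ≤ |X.col j ⬝ᵥ e|}) (by
        intro e he hR u
        left
        simp only [Set.mem_ofPred_eq, not_exists, not_le] at hR
        refine (dotProduct_mulVec_le_of_abs_le (fun j => (hR j).le) u).trans ?_
        rw [← mul_assoc]
        refine mul_le_mul_of_nonneg_right ?_ (l1_nonneg u)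
        have e1 : θ * (A * √(2 * Real.log p / n)) * √(n : ℝ) = θ * A * √(2 * Real.log p) := by
          rw [Real.sqrt_div (by positivity)]; field_simp
        rw [e1]
        have := mul_le_mul_of_nonneg_right (hlow e he)
          (by positivity : 0 ≤ θ * A * √(2 * Real.log p))
        rw [ht, hb]; linarith)
    have hcol := stdNormal_real_exists_col_le X hn hX ht0
    have e2 : (p : ℝ) * (2 * Real.exp (-t ^ 2 / 2)) = 2 * (p : ℝ) ^ (-(b ^ 2 - 1)) := by
      have hp0 : (0 : ℝ) < p := by linarith
      have e3 : -t ^ 2 / 2 = -(b ^ 2) * Real.log p := by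
        rw [ht, mul_pow, Real.sq_sqrt (by positivity)]; ring
      have e4 : -(b ^ 2 - 1) = 1 + -(b ^ 2) := by ring
      rw [e3, e4, Real.rpow_add hp0, Real.rpow_one, mul_comm (-(b ^ 2)), Real.rpow_def_of_pos hp0]
      ring
    have := hL p ((le_max_left _ _).trans hp)
    linarith
  · have hpL : (p : ℝ) ≤ L + 1 := by
      have : p ≤ L + 1 := by omega
      exact_mod_cast this
    have hK : (0 : ℝ) < 2 * (L + 1) / η := by positivity
    have hsum := measureReal_compl_goodNoise_le_add X
      (τ := θ * (A * √(2 * Real.log p / n))) (a := √(8 * (L + 1) / η / n)) (δ := δ')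
      (R := {e | ¬ ∀ u, e ⬝ᵥ (X *ᵥ u) ≤ √(2 * (L + 1) / η) * l2 (X *ᵥ u)}) (by
        intro e he hR u
        right
        simp only [Set.mem_ofPred_eq, not_not] at hR
        refine (hR u).trans ?_
        rw [← mul_assoc]
        refine mul_le_mul_of_nonneg_right ?_ (l2_nonneg _)
        have e1 : √(8 * (L + 1) / η / n) = 2 * √(2 * (L + 1) / η) / √(n : ℝ) := by
          rw [Real.sqrt_div (by positivity)]
          congr 1
          rw [show 8 * ((L : ℝ) + 1) / η = 2 ^ 2 * (2 * (L + 1) / η) by ring,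
            Real.sqrt_mul (by norm_num), Real.sqrt_sq (by norm_num)]
        have e2 : √(n : ℝ) / 2 ≤ l2 e := by
          have := hlow e he
          have := mul_le_mul_of_nonneg_right hδ'2 hn0.le
          linarith
        rw [e1, ← mul_div_assoc, le_div_iff₀ hn0]
        have := mul_le_mul_of_nonneg_right e2 (Real.sqrt_nonneg (2 * (L + 1) / η))
        linarith)
    have hproj := stdNormal_real_not_proj_le X hK
    have e3 : (p : ℝ) / (2 * (L + 1) / η) ≤ η / 2 := by
      rw [div_le_iff₀ hK]
      have : η / 2 * (2 * ((L : ℝ) + 1) / η) = L + 1 := by field_simp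
      rw [this]; exact hpL
    linarith

end GoodNoise

/-! ### Asymptotics and conclusion. -/

/-- Each `u` in the cone bounds the infimum defining `compat` from above. The resulting `ρ` makes
`√n ρ = 2 A² t`, as small as desired. -/
lemma compatBound_of_div_le {n p : ℕ} {X : Matrix (Fin n) (Fin p) ℝ} {S : Finset (Fin p)}
    {ξ A t : ℝ} (hn : n ≠ 0) (ht : 0 < t)
    (h : ENNReal.ofReal (S.card * √(Real.log p ^ 2 / n)) / compat ξ S X ^ 2 ≤ ENNReal.ofReal t) :
    CompatBound X S ξ (A * √(2 * Real.log p / n)) (2 * A ^ 2 * t / √(n : ℝ)) := by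
  intro u hu
  have hn0 : (0 : ℝ) < √(n : ℝ) := Real.sqrt_pos.2 (by positivity)
  have hnn : √(n : ℝ) ^ 2 = n := Real.sq_sqrt (by positivity)
  have hℓ : 0 ≤ Real.log p := Real.log_natCast_nonneg p
  set ℓ := Real.log p with hℓdef
  set m := ∑ j ∈ S, |u j| with hm
  have hm0 : 0 ≤ m := Finset.sum_nonneg fun _ _ => abs_nonneg _
  rcases hm0.eq_or_lt with h0 | hmpos
  · rw [← h0]; simp only [mul_zero, ne_eq, OfNat.ofNat_ne_zero, not_false_eq_true, zero_pow]
    positivity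
  have hu0 : u ≠ 0 := by
    rintro rfl
    simp [hm] at hmpos
  have hs : 0 < S.card := by
    rw [Finset.card_pos, Finset.nonempty_iff_ne_empty]
    rintro rfl
    simp [hm] at hmpos
  have hs' : (0 : ℝ) < S.card := by exact_mod_cast hs
  set r := (l2 (X *ᵥ u) / √(n : ℝ)) / (m / √(S.card : ℝ)) with hr
  have hr0 : 0 ≤ r := by have := l2_nonneg (X *ᵥ u); positivity
  have hκ : compat ξ S X ≤ ENNReal.ofReal r := iInf₂_le u ⟨hu0, hu⟩
  have h1 : ENNReal.ofReal (S.card * √(ℓ ^ 2 / n)) / ENNReal.ofReal (r ^ 2) ≤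
      ENNReal.ofReal t := by
    refine le_trans (ENNReal.div_le_div_left ?_ _) h
    rw [ENNReal.ofReal_pow hr0]
    exact pow_le_pow_left' hκ 2
  -- Finiteness of the right side covers `r = 0`, where the quotient could be infinite.
  rw [ENNReal.div_le_iff_le_mul (Or.inr ENNReal.ofReal_ne_top) (Or.inl ENNReal.ofReal_ne_top),
    ← ENNReal.ofReal_mul ht.le, ENNReal.ofReal_le_ofReal_iff (by positivity),
    Real.sqrt_div (by positivity), Real.sqrt_sq hℓ] at h1
  have h2 : r ^ 2 = l2 (X *ᵥ u) ^ 2 / n * (S.card / m ^ 2) := by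
    rw [hr, div_pow, div_pow, div_pow, hnn, Real.sq_sqrt hs'.le]
    field_simp
  rw [h2] at h1
  set V := l2 (X *ᵥ u) ^ 2 / n
  have h3 : ℓ * m ^ 2 / √(n : ℝ) ≤ t * V := by
    have h4 := mul_le_mul_of_nonneg_left h1 (by positivity : 0 ≤ m ^ 2 / S.card)
    have e1 : m ^ 2 / S.card * (S.card * (ℓ / √(n : ℝ))) = ℓ * m ^ 2 / √(n : ℝ) := by
      field_simp
    have e2 : m ^ 2 / S.card * (t * (V * (S.card / m ^ 2))) = t * V := by
      field_simp
    rwa [e1, e2] at h4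
  have h5 := mul_le_mul_of_nonneg_left h3 (by positivity : 0 ≤ 2 * A ^ 2 / √(n : ℝ))
  have e3 : (A * √(2 * ℓ / n) * m) ^ 2 = 2 * A ^ 2 / √(n : ℝ) * (ℓ * m ^ 2 / √(n : ℝ)) := by
    rw [mul_pow, mul_pow, Real.sq_sqrt (by positivity)]
    have e4 : 2 * A ^ 2 / √(n : ℝ) * (ℓ * m ^ 2 / √(n : ℝ)) =
        2 * A ^ 2 * (ℓ * m ^ 2) / √(n : ℝ) ^ 2 := by ring
    rw [e4, hnn]; ring
  rw [e3]
  refine h5.trans (le_of_eq ?_)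
  ring

lemma exists_gaussian_tail_le {η : ℝ} (hη : 0 < η) :
    ∃ K : ℝ, 0 ≤ K ∧ (gaussianReal 0 1).real {x | K ≤ |x|} ≤ η := by
  have h : Tendsto (fun t : ℝ => 2 * Real.exp (-t ^ 2 / 2)) atTop (𝓝 (2 * 0)) := by
    refine Tendsto.const_mul 2 (Real.tendsto_exp_atBot.comp ?_)
    refine Tendsto.atBot_div_const (by norm_num) ?_
    exact tendsto_neg_atTop_atBot.comp (tendsto_pow_atTop (by norm_num))
  rw [mul_zero] at h
  obtain ⟨K, hK, hK0⟩ := ((h.eventually_le_const hη).and (eventually_ge_atTop 0)).exists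
  exact ⟨K, hK0, (gaussianReal_real_abs_ge_le K hK0).trans hK⟩

/-- For large `n`, the normal approximation holds uniformly, and for the bootstrap it does so on
an event of probability close to one. -/
theorem eventually_exists_normal_approx
    (p : ℕ → ℕ) (X : ∀ n, Matrix (Fin n) (Fin (p n)) ℝ) (S : ∀ n, Finset (Fin (p n)))
    (σ A₁ A₂ ξ : ℝ) (hσ : 0 < σ) (hA₁ : 1 < A₁) (hA₂ : 0 < A₂)
    (hξ : (A₁ + 1) / (A₁ - 1) < ξ)
    (hX : ∀ n k, l2 ((X n).col k) = √(n : ℝ))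
    (lam γ : ℕ → ℝ)
    (hlam : ∀ n, lam n = A₁ * √(2 * Real.log (p n) / n))
    (hγ : ∀ n, γ n = A₂ * √(2 * Real.log (p n) / n))
    (hcompat : Tendsto (fun n =>
      ENNReal.ofReal ((S n).card * √(Real.log (p n) ^ 2 / n)) / compat ξ (S n) (X n) ^ 2)
      atTop (𝓝 0))
    (Psi : ∀ n (k : Fin (p n)), {j : Fin (p n) // j ≠ k} → ℝ)
    (hPsi : ∀ n k, IsSqrtLasso (dropCol (X n) k) (γ n) ((X n).col k) (Psi n k))
    (hW : ∀ᶠ n in atTop, ∀ k, k ∉ S n → nodewiseResid (X n) k (Psi n k) ≠ 0)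
    (Theta : ∀ n (k : Fin (p n)), (Fin n → ℝ) → ({j : Fin (p n) // j ≠ k} → ℝ))
    (hTheta : ∀ n k y, IsSqrtLasso (dropCol (X n) k) (lam n) y (Theta n k y))
    (bhat : ∀ n, (Fin n → ℝ) → (Fin (p n) → ℝ))
    (hbhat : ∀ n y, IsSqrtLasso (X n) (lam n) y (bhat n y)) {η : ℝ} (hη : 0 < η) :
    ∀ᶠ n in atTop, ∃ G : Set (Fin n → ℝ), (stdNormal n).real Gᶜ ≤ η ∧
      ∀ k, k ∉ S n → ∀ β ∈ supportedOn (S n), ∀ x,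
        |statCDF (X n) k (Psi n k) (Theta n k) β σ x - Phi x| ≤ 3 * η ∧
        ∀ e ∈ G, |bootCDF (X n) k (Psi n k) (Theta n k) (bhat n) β σ e x - Phi x| ≤ 3 * η := by
  have hA0 : 0 < A₁ := by linarith
  have hA1 : 0 < A₁ - 1 := by linarith
  have hξA : A₁ + 1 < ξ * (A₁ - 1) := by rwa [div_lt_iff₀ hA1] at hξ
  have hξ1 : 1 < ξ := by nlinarith
  have hξ2 : 0 < ξ + 1 := by linarith
  have hθ' : 1 / A₁ < (ξ - 1) / (ξ + 1) := by
    rw [div_lt_div_iff₀ hA0 hξ2]; linarith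
  -- `θ > 1 / A₁` puts `θ λ` above the noise level `√(2 log p / n)`, and `θ < (ξ - 1) / (ξ + 1)`
  -- means `(1 + θ) / (1 - θ) < ξ`. The hypothesis on `ξ` leaves room for both.
  obtain ⟨θ, hθA, hθξ⟩ := exists_between hθ'
  have hθ0 : 0 < θ := lt_trans (by positivity) hθA
  have hAθ : 1 < θ * A₁ := by rwa [div_lt_iff₀ hA0] at hθA
  rw [lt_div_iff₀ hξ2] at hθξ
  have hθ1 : θ < 1 := by nlinarith
  have hξθ : 1 + θ < ξ * (1 - θ) := by linarith
  obtain ⟨K₁, hK₁, hK₁η⟩ := exists_gaussian_tail_le hη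
  have hδ₀ : 0 < η / (1 + K₁) := by positivity
  have hB : 0 ≤ A₂ / A₁ := by positivity
  obtain ⟨δ, ω, hδ, -, hω, hclose⟩ := exists_closeness hθ0.le hθ1 hξθ hB hδ₀
  obtain ⟨K, hK, hgood⟩ := exists_eventually_goodNoise hA0 hθ0 hAθ hδ hη
  -- Compatibility then uses half of the budget `ω`; the term `K / √n` from `a²` uses the other
  -- half.
  set t := ω / (4 * A₁ ^ 2) with ht
  have ht0 : 0 < t := by positivity
  have hKn : Tendsto (fun n : ℕ => K / √(n : ℝ)) atTop (𝓝 0) :=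
    tendsto_const_nhds.div_atTop (Real.tendsto_sqrt_atTop.comp tendsto_natCast_atTop_atTop)
  filter_upwards [hgood, hKn.eventually_le_const (by positivity : 0 < ω / 2),
    hcompat.eventually_le_const (ENNReal.ofReal_pos.2 ht0), hW, eventually_ne_atTop 0]
    with n hgn hKn hcn hWn hn
  have hn0 : (0 : ℝ) < √(n : ℝ) := Real.sqrt_pos.2 (by positivity)
  have hnn : √(n : ℝ) ^ 2 = n := Real.sq_sqrt (by positivity)
  have hcomp := compatBound_of_div_le (A := A₁) hn ht0 hcn
  have hprob := hgn (p n) (X n) (hX n)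
  rw [← hlam] at hcomp hprob
  have hl0 : 0 ≤ lam n := by rw [hlam]; positivity
  have hpsi : ∀ k, IsSqrtLasso (dropCol (X n) k) (A₂ / A₁ * lam n) ((X n).col k) (Psi n k) := by
    intro k
    have : A₂ / A₁ * lam n = γ n := by rw [hlam, hγ]; field_simp
    rw [this]; exact hPsi n k
  have hsmall : √(n : ℝ) * (2 * A₁ ^ 2 * t / √(n : ℝ) + √(K / n) ^ 2) ≤ ω := by
    have e1 : √(n : ℝ) * (2 * A₁ ^ 2 * t / √(n : ℝ) + √(K / n) ^ 2) =
        2 * A₁ ^ 2 * t + K / √(n : ℝ) := by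
      rw [Real.sq_sqrt (by positivity), mul_add]
      nth_rewrite 4 [← hnn]
      field_simp
    have e2 : 2 * A₁ ^ 2 * t = ω / 2 := by rw [ht]; field_simp; norm_num
    rw [e1, e2]; linarith
  refine ⟨_, hprob, fun k hk β hβ x => ?_⟩
  have hcl := fun e he => hclose (X n) (S n) (lam n) (2 * A₁ ^ 2 * t / √(n : ℝ)) √(K / n) σ k
    (Psi n k) (Theta n k) (bhat n) β e hn hl0 (by positivity) (Real.sqrt_nonneg _) hσ hk hsmall
    hcomp (hpsi k) (hWn k hk) (hTheta n k) (hbhat n) hβ he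
  set W := nodewiseResid (X n) k (Psi n k) with hWdef
  have hW0 : 0 < l2 W := l2_pos (hWn k hk)
  have hZ : (fun e => W ⬝ᵥ e / l2 W) = fun e => ((l2 W)⁻¹ • W) ⬝ᵥ e := by
    ext e; rw [smul_dotProduct, smul_eq_mul, inv_mul_eq_div]
  have hunit : l2 ((l2 W)⁻¹ • W) = 1 := by
    rw [l2_smul, abs_of_pos (inv_pos.2 hW0), inv_mul_cancel₀ hW0.ne']
  have hmeas : Measurable fun e => W ⬝ᵥ e / l2 W := by rw [hZ]; exact measurable_dotProduct _
  have hlaw : (stdNormal n).map (fun e => W ⬝ᵥ e / l2 W) = gaussianReal 0 1 := by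
    rw [hZ]; exact map_dotProduct_stdNormal hunit
  have hfin : 2 * η + η / (1 + K₁) * (1 + K₁) = 3 * η := by
    rw [div_mul_cancel₀ _ (by positivity)]; ring
  refine ⟨?_, fun e he => ?_⟩
  · rw [← hfin]
    exact abs_measureReal_sub_Phi_le hmeas hlaw hprob hK₁η hK₁ hδ₀.le
      (fun e he => (hcl e he).1) x
  · rw [← hfin]
    exact abs_measureReal_sub_Phi_le hmeas hlaw hprob hK₁η hK₁ hδ₀.le (hcl e he).2 x

end SqrtLassoTest

open SqrtLassoTest in
theorem mainTheorem3
    (p : ℕ → ℕ) (X : ∀ n, Matrix (Fin n) (Fin (p n)) ℝ) (S : ∀ n, Finset (Fin (p n)))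
    (σ A₁ A₂ ξ : ℝ) (hσ : 0 < σ) (hA₁ : 1 < A₁) (hA₂ : 0 < A₂)
    (hξ : (A₁ + 1) / (A₁ - 1) < ξ)
    -- the columns of the design are scaled to have Euclidean norm `√n`
    (hX : ∀ n k, l2 ((X n).col k) = √(n : ℝ))
    -- the tuning parameters
    (lam γ : ℕ → ℝ)
    (hlam : ∀ n, lam n = A₁ * √(2 * Real.log (p n) / n))
    (hγ : ∀ n, γ n = A₂ * √(2 * Real.log (p n) / n))
    -- `s √(log(p)² / n) / κ²(ξ, S) → 0`
    (hcompat : Tendsto (fun n =>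
      ENNReal.ofReal ((S n).card * √(Real.log (p n) ^ 2 / n)) / compat ξ (S n) (X n) ^ 2)
      atTop (𝓝 0))
    -- nodewise square-root Lasso solutions `Ψ_k`, with residuals `W_k`
    (Psi : ∀ n (k : Fin (p n)), {j : Fin (p n) // j ≠ k} → ℝ)
    (hPsi : ∀ n k, IsSqrtLasso (dropCol (X n) k) (γ n) ((X n).col k) (Psi n k))
    (hW : ∀ᶠ n in atTop, ∀ k, k ∉ S n → nodewiseResid (X n) k (Psi n k) ≠ 0)
    -- the square-root Lasso regression of a response on `X_{-k}`, and on the whole of `X`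
    (Theta : ∀ n (k : Fin (p n)), (Fin n → ℝ) → ({j : Fin (p n) // j ≠ k} → ℝ))
    (hTheta : ∀ n k y, IsSqrtLasso (dropCol (X n) k) (lam n) y (Theta n k y))
    (bhat : ∀ n, (Fin n → ℝ) → (Fin (p n) → ℝ))
    (hbhat : ∀ n y, IsSqrtLasso (X n) (lam n) y (bhat n y)) :
    Tendsto (fun n =>
      ⨆ (k : Fin (p n)) (_ : k ∉ S n) (β : Fin (p n) → ℝ) (_ : β ∈ supportedOn (S n)) (x : ℝ),
        ENNReal.ofReal |statCDF (X n) k (Psi n k) (Theta n k) β σ x - Phi x|)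
      atTop (𝓝 0) ∧
    ∀ η : ℝ, 0 < η →
      Tendsto (fun n => stdNormal n {e | ENNReal.ofReal η <
        ⨆ (k : Fin (p n)) (_ : k ∉ S n) (β : Fin (p n) → ℝ) (_ : β ∈ supportedOn (S n)) (x : ℝ),
          ENNReal.ofReal |bootCDF (X n) k (Psi n k) (Theta n k) (bhat n) β σ e x - Phi x|})
        atTop (𝓝 0) := by
  have approx := fun (η : ℝ) (hη : 0 < η) => eventually_exists_normal_approx p X S σ A₁ A₂ ξ hσ hA₁
    hA₂ hξ hX lam γ hlam hγ hcompat Psi hPsi hW Theta hTheta bhat hbhat hη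
  have hreal : ∀ ε : ℝ≥0∞, 0 < ε → ∃ c : ℝ, 0 < c ∧ ENNReal.ofReal c ≤ ε := fun ε hε => by
    refine ⟨(min ε 1).toReal, ENNReal.toReal_pos (by positivity) (by simp), ?_⟩
    rw [ENNReal.ofReal_toReal (by simp)]
    exact min_le_left _ _
  refine ⟨ENNReal.tendsto_nhds_zero.2 fun ε hε => ?_, fun η hη =>
    ENNReal.tendsto_nhds_zero.2 fun ε hε => ?_⟩
  · obtain ⟨c, hc, hcε⟩ := hreal ε hε
    filter_upwards [approx (c / 3) (by positivity)] with n hn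
    obtain ⟨G, -, h⟩ := hn
    refine iSup_le fun k => iSup_le fun hk => iSup_le fun β => iSup_le fun hβ => iSup_le fun x => ?_
    refine le_trans (ENNReal.ofReal_le_ofReal ?_) hcε
    linarith [(h k hk β hβ x).1]
  · obtain ⟨c, hc, hcε⟩ := hreal ε hε
    -- `η / 3` makes the deviation on `G` at most `η`; `c` bounds the probability of `Gᶜ`.
    have hmin : 0 < min (η / 3) c := by positivity
    filter_upwards [approx (min (η / 3) c) hmin] with n hn
    obtain ⟨G, hG, h⟩ := hn
    have hsub : {e | ENNReal.ofReal η <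
        ⨆ (k : Fin (p n)) (_ : k ∉ S n) (β : Fin (p n) → ℝ) (_ : β ∈ supportedOn (S n)) (x : ℝ),
          ENNReal.ofReal |bootCDF (X n) k (Psi n k) (Theta n k) (bhat n) β σ e x - Phi x|} ⊆
        Gᶜ := by
      intro e he heG
      rw [Set.mem_ofPred_eq] at he
      refine absurd he (not_lt.2 ?_)
      refine iSup_le fun k => iSup_le fun hk => iSup_le fun β => iSup_le fun hβ =>
        iSup_le fun x => ENNReal.ofReal_le_ofReal ?_
      linarith [(h k hk β hβ x).2 e heG, min_le_left (η / 3) c]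
    refine (measure_mono hsub).trans (le_trans ?_ hcε)
    rw [← ofReal_measureReal]
    exact ENNReal.ofReal_le_ofReal (hG.trans (min_le_right _ _))
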